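/- **Model.** Let $\mathcal I,\mathcal J$ be finite non-empty sets of customer classes and server pools, let $\lambda_i>0$, $\beta_j>0$, $\mu_{ij}\ge 0$. The static planning problem is to minimise $\rho$ over $(\lambda_{ij}),\rho$ subject to $\lambda_{ij}\ge 0$, $\sum_j\lambda_{ij}=\lambda_i$ for all $i$, and $\sum_i \lambda_{ij}/(\beta_j\mu_{ij})\le\rho$ for all $j$ (with $\lambda_{ij}=0$ whenever $\mu_{ij}=0$). Assume complete resource pooling: the optimal solution $(\lambda_{ij}),\rho$ is unique, and the set $\mathcal E=\{(i,j):\lambda_{ij}>0\}$ of basic activities is the edge set of a (connected) tree on the vertex set $\mathcal I\sqcup\mathcal J$. Let $(\nu_i),(\alpha_j)$ be optimal dual variables, i.e. maximisers of $\sum_i\lambda_i\nu_i$ subject to $\nu_i\beta_j\mu_{ij}\le\alpha_j$, $\alpha_j\ge 0$, $\sum_j\alpha_j=1$. **Halfin–Whitt regime.** Assume $\rho=1$, and let $l_i\in\mathbb R$ be such that $\sum_i l_i\nu_i=-C<0$. Let the scaling parameter $r>0$ tend to infinity along a sequence for which all $r\beta_j$ are integers. In the $r$-th system class $i$ customers arrive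 as a Poisson process of rate $\lambda_i^r=r\lambda_i+\sqrt r\,l_i$ (positive for large $r$), pool $j$ has $r\beta_j$ servers, only activities in $\mathcal E$ are used, a pool $j$ server serves a class $i$ customer for an exponential time of rate $\mu_{ij}$, and customers do not abandon. Let $Q_i^r$ be the number of class $i$ customers waiting, let $\Psi_j^r$ be the number of busy servers in pool $j$, and put $\hat Q_i^r=Q_i^r/\sqrt r\ge 0$ and $\hat Z_j^r=(\Psi_j^r-r\beta_j)/\sqrt r\le 0$. **LQFS-LB rule.** An arriving class $i$ customer that sees an idle server in some pool $j$ with $(i,j)\in\mathcal E$ enters service in such a pool with the smallest load $\Psi_j^r/\beta_j$; otherwise it joins the queue of its class. A pool $j$ server that completes a service takes a customer from a longest queue among the classes $i$ with $(i,j)\in\mathcal E$, if any of these queues is non-empty, and otherwise becomes idle. Ties are broken in an arbitrary Markovian manner, possibly depending on $r$. **Theorem.** Suppose in addition that there are $\mu_j$ such that $\mu_{ij}=\mu_j$ for all $(i,j)\in\mathcal E$. For all large $r$ let the $r$-th system be in a stationary distribution. Then for every real $$\theta<\theta_0:=\frac{2\,C\,\min_i\lambda_i}{\sum_i\lambda_i+(\max_j\mu_j)\sum_j\beta_j}$$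 one has $$\limsup_{r\to\infty}\ \mathbb E\Big[\sum_i\exp(\theta\hat Q_i^r)+\sum_j\beta_j\exp(\theta\hat Z_j^r/\beta_j)\Big]<\infty .$$ In particular, the stationary distributions of $\big((\hat Q_i^r)_i,(\hat Z_j^r)_j\big)$ form a tight family of probability measures on $\mathbb R^{\mathcal I}\times\mathbb R^{\mathcal J}$. -/

import Mathlib

/-! Parallel many-server systems with several customer classes `I` and server pools `J`:
the static planning problem, the LQFS-LB policy and its Markov chain. -/

noncomputable section

namespace LQFS

/-! ### Static planning problem -/

/-- Feasible points `(x, ρ)` of the static planning problem: minimise `ρ` subject to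
`x i j ≥ 0`, `∑ j, x i j = lam i`, `∑ i, x i j / (β j * μ i j) ≤ ρ`. A pair with `μ i j = 0`
cannot be used, so that `x i j = 0` there. -/
def SPPFeasible {I J : Type*} [Fintype I] [Fintype J] (lam : I → ℝ) (β : J → ℝ)
    (μ : I → J → ℝ) (x : I → J → ℝ) (ρ : ℝ) : Prop :=
  (∀ i j, 0 ≤ x i j) ∧ (∀ i j, μ i j = 0 → x i j = 0) ∧ (∀ i, ∑ j, x i j = lam i) ∧
    ∀ j, ∑ i, x i j / (β j * μ i j) ≤ ρ

/-- Optimal solutions of the static planning problem. -/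
def SPPOptimal {I J : Type*} [Fintype I] [Fintype J] (lam : I → ℝ) (β : J → ℝ)
    (μ : I → J → ℝ) (x : I → J → ℝ) (ρ : ℝ) : Prop :=
  SPPFeasible lam β μ x ρ ∧ ∀ x' ρ', SPPFeasible lam β μ x' ρ' → ρ ≤ ρ'

/-- Feasible points of the dual linear program: `ν i ≤ α j / (β j * μ i j)` (a constraint only
when `μ i j ≠ 0`), `α j ≥ 0`, `∑ j, α j = 1`. -/
def DualFeasible {I J : Type*} [Fintype I] [Fintype J] (β : J → ℝ)
    (μ : I → J → ℝ) (ν : I → ℝ) (α : J → ℝ) : Prop :=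
  (∀ j, 0 ≤ α j) ∧ ∑ j, α j = 1 ∧ ∀ i j, ν i * (β j * μ i j) ≤ α j

/-- Optimal dual variables: maximisers of `∑ i, lam i * ν i` over the dual feasible points. -/
def DualOptimal {I J : Type*} [Fintype I] [Fintype J] (lam : I → ℝ) (β : J → ℝ)
    (μ : I → J → ℝ) (ν : I → ℝ) (α : J → ℝ) : Prop :=
  DualFeasible β μ ν α ∧
    ∀ ν' α', DualFeasible β μ ν' α' → ∑ i, lam i * ν' i ≤ ∑ i, lam i * ν i

/-- The basic activities: the pairs used by the solution `x`. -/
def Basic {I J : Type*} (x : I → J → ℝ) (i : I) (j : J) : Prop := 0 < x i j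

/-- The bipartite graph on `I ⊕ J` whose edges are the pairs `(i, j)` with `E i j`. -/
def activityGraph {I J : Type*} (E : I → J → Prop) : SimpleGraph (I ⊕ J) :=
  SimpleGraph.fromRel fun a b => ∃ i j, a = Sum.inl i ∧ b = Sum.inr j ∧ E i j

/-- Complete resource pooling: `(x, ρ)` is the unique optimal solution of the static planning
problem and its basic activities form a (connected) tree. -/
def CompleteResourcePooling {I J : Type*} [Fintype I] [Fintype J] (lam : I → ℝ) (β : J → ℝ)
    (μ : I → J → ℝ) (x : I → J → ℝ) (ρ : ℝ) : Prop :=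
  SPPOptimal lam β μ x ρ ∧ (∀ x' ρ', SPPOptimal lam β μ x' ρ' → x' = x ∧ ρ' = ρ) ∧
    (activityGraph (Basic x)).IsTree

/-! ### States and transitions -/

/-- State of the system: `queue i` customers of class `i` wait, and `busy i j` servers of pool `j`
serve customers of class `i`. -/
@[ext] structure State (I J : Type*) where
  queue : I → ℕ
  busy : I → J → ℕ

/-- Number of busy servers in pool `j`. -/
def State.total {I J : Type*} [Fintype I] (s : State I J) (j : J) : ℕ := ∑ i, s.busy i j

/-- A class-`i` customer joins the queue. -/
def State.enqueue {I J : Type*} [DecidableEq I] (s : State I J) (i : I) : State I J where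
  queue := Function.update s.queue i (s.queue i + 1)
  busy := s.busy

/-- A waiting class-`i` customer leaves the queue. -/
def State.dequeue {I J : Type*} [DecidableEq I] (s : State I J) (i : I) : State I J where
  queue := Function.update s.queue i (s.queue i - 1)
  busy := s.busy

/-- A server of pool `j` starts to serve a class-`i` customer. -/
def State.start {I J : Type*} [DecidableEq I] [DecidableEq J] (s : State I J) (i : I) (j : J) :
    State I J where
  queue := s.queue
  busy := Function.update s.busy i (Function.update (s.busy i) j (s.busy i j + 1))

/-- A server of pool `j` completes the service of a class-`i` customer. -/
def State.complete {I J : Type*} [DecidableEq I] [DecidableEq J] (s : State I J) (i : I) (j : J) :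
    State I J where
  queue := s.queue
  busy := Function.update s.busy i (Function.update (s.busy i) j (s.busy i j - 1))

/-- The states of the system with activities `E` and pool sizes `N`: only activities in `E` are
used, no pool is over capacity, and no customer waits while a compatible server is idle. -/
def Admissible {I J : Type*} [Fintype I] (E : I → J → Prop) (N : J → ℕ) (s : State I J) : Prop :=
  (∀ i j, ¬ E i j → s.busy i j = 0) ∧ (∀ j, s.total j ≤ N j) ∧
    ∀ i j, E i j → 0 < s.queue i → s.total j = N j

/-- An arriving class-`i` customer sees an unoccupied server in some compatible pool. -/
def SeesIdle {I J : Type*} [Fintype I] (E : I → J → Prop) (N : J → ℕ) (s : State I J) (i : I) :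
    Prop :=
  ∃ j, E i j ∧ s.total j < N j

/-- A server of pool `j` sees a customer of a compatible class in queue. -/
def SeesWaiting {I J : Type*} (E : I → J → Prop) (s : State I J) (j : J) : Prop :=
  ∃ i, E i j ∧ 0 < s.queue i

/-- Instantaneous load of pool `j`. -/
def load {I J : Type*} [Fintype I] (β : J → ℝ) (s : State I J) (j : J) : ℝ := (s.total j : ℝ) / β j

/-- An LQFS-LB policy, that is, the LQFS-LB rule together with a Markovian way to break ties.
In state `s`, an arriving class-`i` customer that sees an unoccupied compatible server goes to a
pool drawn from `route s i`, which is concentrated on the least loaded compatible pools.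
A server of pool `j` that completes the service of a class-`i` customer in state `s` and sees
compatible customers in queue takes one of a class drawn from `sched s i j`, which is concentrated
on the compatible classes with the longest queue. -/
structure Policy {I J : Type*} [Fintype I] (E : I → J → Prop) (β : J → ℝ) (N : J → ℕ) where
  route : State I J → I → PMF J
  sched : State I J → I → J → PMF I
  route_mem : ∀ s i, SeesIdle E N s i → ∀ j ∈ (route s i).support,
    E i j ∧ ∀ j', E i j' → load β s j ≤ load β s j'
  sched_mem : ∀ s i j, SeesWaiting E s j → ∀ k ∈ (sched s i j).support,
    E k j ∧ ∀ k', E k' j → s.queue k' ≤ s.queue k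

open Classical in
/-- Law of the state right after a class-`i` arrival in state `s`. -/
def afterArrival {I J : Type*} [Fintype I] [DecidableEq I] [DecidableEq J] {E : I → J → Prop}
    {β : J → ℝ} {N : J → ℕ} (P : Policy E β N) (s : State I J) (i : I) : PMF (State I J) :=
  if SeesIdle E N s i then (P.route s i).map fun j => s.start i j else PMF.pure (s.enqueue i)

open Classical in
/-- Law of the state right after a pool-`j` server completes a class-`i` service in state `s`. -/
def afterService {I J : Type*} [Fintype I] [DecidableEq I] [DecidableEq J] {E : I → J → Prop}
    {β : J → ℝ} {N : J → ℕ} (P : Policy E β N) (s : State I J) (i : I) (j : J) :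
    PMF (State I J) :=
  if SeesWaiting E s j then (P.sched s i j).map fun k => ((s.complete i j).dequeue k).start k j
  else PMF.pure (s.complete i j)

/-- Transition rate from `s` to `t` of the continuous-time Markov chain with Poisson arrivals of
rates `a i` and exponential services of rates `μ i j`. -/
def rate {I J : Type*} [Fintype I] [Fintype J] [DecidableEq I] [DecidableEq J] {E : I → J → Prop}
    {β : J → ℝ} {N : J → ℕ} (P : Policy E β N) (a : I → ℝ) (μ : I → J → ℝ) (s t : State I J) :
    ENNReal :=
  ∑ i, ENNReal.ofReal (a i) * afterArrival P s i t +
    ∑ i, ∑ j, ENNReal.ofReal (μ i j * s.busy i j) * afterService P s i j t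

/-- Stationary distributions of the chain: probability measures `p` on the admissible states that
satisfy the global balance equations. (From an admissible state the total transition rate is at
most `∑ i, a i + ∑ i, ∑ j, μ i j * N j`, so that the chain does not explode and these are exactly
its invariant laws.) -/
def IsStationary {I J : Type*} [Fintype I] [Fintype J] [DecidableEq I] [DecidableEq J]
    {E : I → J → Prop} {β : J → ℝ} {N : J → ℕ} (P : Policy E β N) (a : I → ℝ) (μ : I → J → ℝ)
    (p : PMF (State I J)) : Prop :=
  (∀ s, p s ≠ 0 → Admissible E N s) ∧
    ∀ t, p t * ∑' u, rate P a μ t u = ∑' s, p s * rate P a μ s t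

/-! ### Diffusion scaling -/

/-- Diffusion-scaled queue length `Q i / √r`. -/
def scaledQueue {I J : Type*} (r : ℝ) (s : State I J) (i : I) : ℝ := (s.queue i : ℝ) / √r

/-- Diffusion-scaled number of idle servers with the minus sign, `(Ψ j - r * β j) / √r`. -/
def scaledIdle {I J : Type*} [Fintype I] (β : J → ℝ) (r : ℝ) (s : State I J) (j : J) : ℝ :=
  ((s.total j : ℝ) - r * β j) / √r

/-- The law of the diffusion-scaled queues and idleness when the state has law `p`. -/
def scaledLaw {I J : Type*} [Fintype I] (β : J → ℝ) (r : ℝ) (p : PMF (State I J)) :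
    MeasureTheory.Measure ((I → ℝ) × (J → ℝ)) :=
  (p.map fun s => (scaledQueue r s, scaledIdle β r s)).toMeasure

/-- `∑ i, exp (θ * Q̂ i) + ∑ j, β j * exp (θ * Ẑ j / β j)`. -/
def expFunctional {I J : Type*} [Fintype I] [Fintype J] (β : J → ℝ) (r θ : ℝ) (s : State I J) :
    ℝ :=
  ∑ i, Real.exp (θ * scaledQueue r s i) + ∑ j, β j * Real.exp (θ * scaledIdle β r s j / β j)

/-- Expectation (possibly infinite) of a nonnegative function under `p`. -/
def expect {I J : Type*} (p : PMF (State I J)) (f : State I J → ℝ) : ENNReal :=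
  ∑' s, p s * ENNReal.ofReal (f s)

end LQFS

end

namespace LQFS

/-! ### Functions and flows on the activity graph -/

/-! The proof applies the Foster–Lyapunov method to F = `expFunctional`. The weights β_j make all
events alike to first order: an arrival or completion acting at level y changes F by about ±θ
e^{θy}/√r, whether it moves a queue or the load of a pool. Let y_i be the level at which class i
arrivals act, w_j the level at which pool j completions act, and put u_i = e^{θ y_i}, v_j = e^{θ
w_j}. Every pool is critical (`sum_flow_eq_capacity`), so the optimal flow x has marginals λ_i and
β_j m_j, and the dominant drift term is −√r θ D with D = ∑ x_ij (v_j − u_i)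
(`CriticalFlow.sum_eq_priceDrift`). LQFS-LB sends arrivals to the lowest and completions to the
highest level available, so y_i ≤ w_j on every basic activity (`exists_actionLevels`). Hence that
term is never positive, whatever the sign of θ.

Let θ > 0, Λ = ∑ λ_i and M = max_j v_j. By connectivity, D bounds the oscillation of the prices
(`exists_oscillation_bound`), so in ∑ l_i u_i each u_i may be replaced by M at a cost that √r D
absorbs for large r. The optimal dual prices all equal 1/Λ (`dual_price_eq`), so ∑ l_i = −CΛ and
this term contributes −θCΛM. The second-order terms of the exponential contribute about θ²ΛM, half
from arrivals and half from completions; the rest is bounded. The drift is thus a constant minus a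
positive multiple of M whenever θ < C. This covers the claim because θ₀ ≤ C.

For θ < 0 the term −√r θ D is dropped. Idle servers reduce the completion rate in proportion to
their number, and the resulting terms −θ β_j m_j z_j e^{θ z_j}, where z_j ≤ 0 is the scaled load,
dominate all others for every negative θ. Tightness follows by Markov's inequality from one positive
and one negative exponent. -/

lemma activityGraph_adj {I J : Type*} {E : I → J → Prop} {a b : I ⊕ J}
    (h : (activityGraph E).Adj a b) :
    (∃ i j, a = Sum.inl i ∧ b = Sum.inr j ∧ E i j) ∨
      ∃ i j, b = Sum.inl i ∧ a = Sum.inr j ∧ E i j := by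
  rw [activityGraph, SimpleGraph.fromRel_adj] at h
  exact h.2

lemma exists_edge_of_class {I J : Type*} [Nonempty J] {E : I → J → Prop}
    (hE : (activityGraph E).Connected) (i : I) : ∃ j, E i j := by
  obtain ⟨j₀⟩ := ‹Nonempty J›
  obtain ⟨w⟩ := hE.preconnected (Sum.inl i) (Sum.inr j₀)
  cases w with
  | cons h _ =>
    rcases activityGraph_adj h with ⟨i', j, hi, -, he⟩ | ⟨i', j, -, hi, he⟩
    · obtain rfl := Sum.inl.inj hi
      exact ⟨j, he⟩
    · cases hi

lemma exists_edge_of_pool {I J : Type*} [Nonempty I] {E : I → J → Prop}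
    (hE : (activityGraph E).Connected) (j : J) : ∃ i, E i j := by
  obtain ⟨i₀⟩ := ‹Nonempty I›
  obtain ⟨w⟩ := hE.preconnected (Sum.inr j) (Sum.inl i₀)
  cases w with
  | cons h _ =>
    rcases activityGraph_adj h with ⟨i', j', hj, -, he⟩ | ⟨i, j', -, hj, he⟩
    · cases hj
    · obtain rfl := Sum.inr.inj hj
      exact ⟨i, he⟩

/-- A function on the vertices that agrees at the ends of every edge is constant. -/
lemma eq_of_connected {I J : Type*} {E : I → J → Prop} (hE : (activityGraph E).Connected)
    {u : I → ℝ} {v : J → ℝ} (h : ∀ i j, E i j → u i = v j) (a b : I ⊕ J) :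
    Sum.elim u v a = Sum.elim u v b := by
  obtain ⟨w⟩ := hE.preconnected a b
  induction w with
  | nil => rfl
  | cons hab _ ih =>
    rw [← ih]
    rcases activityGraph_adj hab with ⟨i, j, rfl, rfl, he⟩ | ⟨i, j, rfl, rfl, he⟩
    · exact h i j he
    · exact (h i j he).symm

/-- If `u i ≤ v j` on the basic activities, the oscillation of `(u, v)` is controlled by
`∑ i, ∑ j, x i j * (v j - u i)`. -/
lemma exists_oscillation_bound {I J : Type*} [Fintype I] [Fintype J] {x : I → J → ℝ}
    (hx : ∀ i j, 0 ≤ x i j) (hE : (activityGraph (Basic x)).Connected) :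
    ∃ K, 0 ≤ K ∧ ∀ (u : I → ℝ) (v : J → ℝ), (∀ i j, Basic x i j → u i ≤ v j) →
      ∀ a b : I ⊕ J, |Sum.elim u v a - Sum.elim u v b| ≤ K * ∑ i, ∑ j, x i j * (v j - u i) := by
  have key : ∀ a b : I ⊕ J, ∃ K, 0 ≤ K ∧ ∀ (u : I → ℝ) (v : J → ℝ),
      (∀ i j, Basic x i j → u i ≤ v j) →
      |Sum.elim u v a - Sum.elim u v b| ≤ K * ∑ i, ∑ j, x i j * (v j - u i) := by
    intro a b
    obtain ⟨w⟩ := hE.preconnected a b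
    induction w with
    | nil => exact ⟨0, le_rfl, fun u v _ => by simp⟩
    | @cons a c b hab _ ih =>
      obtain ⟨K, hK, ih⟩ := ih
      have edge : ∃ i j, Basic x i j ∧ ∀ (u : I → ℝ) (v : J → ℝ), u i ≤ v j →
          |Sum.elim u v a - Sum.elim u v c| = v j - u i := by
        rcases activityGraph_adj hab with ⟨i, j, rfl, rfl, he⟩ | ⟨i, j, rfl, rfl, he⟩
        · exact ⟨i, j, he, fun u v h => by
            simp only [Sum.elim_inl, Sum.elim_inr]; rw [abs_sub_comm, abs_of_nonneg (by linarith)]⟩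
        · exact ⟨i, j, he, fun u v h => by
            simp only [Sum.elim_inl, Sum.elim_inr]; rw [abs_of_nonneg (by linarith)]⟩
      obtain ⟨i, j, he, hd⟩ := edge
      have hxp : 0 < x i j := he
      refine ⟨1 / x i j + K, by positivity, fun u v h => ?_⟩
      have nn : ∀ i j, 0 ≤ x i j * (v j - u i) := by
        intro i j
        rcases (hx i j).lt_or_eq with hp | h0
        · exact mul_nonneg (hx i j) (by linarith [h i j hp])
        · simp [← h0]
      have h1 : x i j * (v j - u i) ≤ ∑ i, ∑ j, x i j * (v j - u i) :=
        (Finset.single_le_sum (f := fun j => x i j * (v j - u i)) (fun j _ => nn i j)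
          (Finset.mem_univ j)).trans
        (Finset.single_le_sum (f := fun i => ∑ j, x i j * (v j - u i))
          (fun i _ => Finset.sum_nonneg fun j _ => nn i j) (Finset.mem_univ i))
      have h2 : v j - u i ≤ 1 / x i j * ∑ i, ∑ j, x i j * (v j - u i) := by
        rw [one_div, ← div_eq_inv_mul, le_div_iff₀ hxp]; linarith
      calc _ ≤ |Sum.elim u v a - Sum.elim u v c| + |Sum.elim u v c - Sum.elim u v b| :=
            abs_sub_le _ _ _
        _ ≤ _ := by rw [hd u v (h i j he), add_mul]; exact add_le_add h2 (ih u v h)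
  choose K hK h using key
  refine ⟨∑ a, ∑ b, K a b, Finset.sum_nonneg fun a _ => Finset.sum_nonneg fun b _ => hK a b,
    fun u v huv a b => (h a b u v huv).trans ?_⟩
  have nn : 0 ≤ ∑ i, ∑ j, x i j * (v j - u i) := by
    refine Finset.sum_nonneg fun i _ => Finset.sum_nonneg fun j _ => ?_
    rcases (hx i j).lt_or_eq with hp | h0
    · exact mul_nonneg (hx i j) (by linarith [huv i j hp])
    · simp [← h0]
  refine mul_le_mul_of_nonneg_right ?_ nn
  exact (Finset.single_le_sum (f := fun b => K a b) (fun b _ => hK a b) (Finset.mem_univ b)).trans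
    (Finset.single_le_sum (f := fun a => ∑ b, K a b)
      (fun a _ => Finset.sum_nonneg fun b _ => hK a b) (Finset.mem_univ a))

/-- On a connected activity graph there is a flow with any prescribed balanced marginals. -/
lemma exists_flow {I J : Type*} [Fintype I] [Fintype J] {E : I → J → Prop}
    (hE : (activityGraph E).Connected) (b : I → ℝ) (c : J → ℝ) (hbc : ∑ i, b i = ∑ j, c j) :
    ∃ d : I → J → ℝ, (∀ i j, ¬ E i j → d i j = 0) ∧ (∀ i, ∑ j, d i j = b i) ∧
      ∀ j, ∑ i, d i j = c j := by
  classical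
  -- A unit flow from `v` to `w` along a walk. Pools carry a minus sign because `d` leaves classes
  -- and enters pools.
  have key : ∀ v w : I ⊕ J, ∃ d : I → J → ℝ, (∀ i j, ¬ E i j → d i j = 0) ∧
      (∀ i, ∑ j, d i j = Pi.single (M := fun _ => ℝ) v 1 (Sum.inl i)
        - Pi.single (M := fun _ => ℝ) w 1 (Sum.inl i)) ∧
      ∀ j, - ∑ i, d i j = Pi.single (M := fun _ => ℝ) v 1 (Sum.inr j)
        - Pi.single (M := fun _ => ℝ) w 1 (Sum.inr j) := by
    intro v w
    obtain ⟨p⟩ := hE.preconnected v w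
    induction p with
    | nil => exact ⟨0, by simp, by simp, by simp⟩
    | @cons v z w hvz _ ih =>
      obtain ⟨d, h0, h1, h2⟩ := ih
      have edge : ∃ d : I → J → ℝ, (∀ i j, ¬ E i j → d i j = 0) ∧
          (∀ i, ∑ j, d i j = Pi.single (M := fun _ => ℝ) v 1 (Sum.inl i)
            - Pi.single (M := fun _ => ℝ) z 1 (Sum.inl i)) ∧
          ∀ j, - ∑ i, d i j = Pi.single (M := fun _ => ℝ) v 1 (Sum.inr j)
            - Pi.single (M := fun _ => ℝ) z 1 (Sum.inr j) := by
        rcases activityGraph_adj hvz with ⟨i₀, j₀, rfl, rfl, he⟩ | ⟨i₀, j₀, rfl, rfl, he⟩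
        · refine ⟨fun i j => if i = i₀ ∧ j = j₀ then 1 else 0, ?_, ?_, ?_⟩
          · rintro i j hij
            refine if_neg ?_
            rintro ⟨rfl, rfl⟩
            exact hij he
          · intro i; by_cases h : i = i₀ <;> simp [h]
          · intro j; by_cases h : j = j₀ <;> simp [h]
        · refine ⟨fun i j => if i = i₀ ∧ j = j₀ then -1 else 0, ?_, ?_, ?_⟩
          · rintro i j hij
            refine if_neg ?_
            rintro ⟨rfl, rfl⟩
            exact hij he
          · intro i; by_cases h : i = i₀ <;> simp [h]
          · intro j; by_cases h : j = j₀ <;> simp [h]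
      obtain ⟨e, e0, e1, e2⟩ := edge
      refine ⟨fun i j => d i j + e i j, fun i j h => by simp [h0 i j h, e0 i j h], fun i => ?_,
        fun j => ?_⟩
      · rw [Finset.sum_add_distrib, h1, e1]; ring
      · rw [Finset.sum_add_distrib, neg_add, h2, e2]; ring
  -- Each vertex ships its signed demand to a fixed root `v₀`; the demands sum to zero, so nothing
  -- accumulates there.
  obtain ⟨v₀⟩ := hE.nonempty
  choose d h0 h1 h2 using fun v => key v v₀
  let B : I ⊕ J → ℝ := Sum.elim b fun j => - c j
  have hB : ∑ v, B v = 0 := by simp [B, hbc]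
  refine ⟨fun i j => ∑ v, B v * d v i j, fun i j h => ?_, fun i => ?_, fun j => ?_⟩
  · simp [h0 _ i j h]
  · rw [Finset.sum_comm]
    simp_rw [← Finset.mul_sum, h1, mul_sub, Finset.sum_sub_distrib, ← Finset.sum_mul, hB]
    simp [B, Pi.single_apply]
  · rw [Finset.sum_comm, ← neg_inj, ← Finset.sum_neg_distrib]
    simp_rw [← Finset.mul_sum, ← mul_neg, h2, mul_sub, Finset.sum_sub_distrib, ← Finset.sum_mul, hB]
    simp [B, Pi.single_apply]

/-! ### Consequences of optimality in the static planning problem -/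

/-- No perturbation of an optimal solution lowers the load of all critical pools. -/
lemma SPPOptimal.no_improvement {I J : Type*} [Fintype I] [Fintype J] [Nonempty J] {lam : I → ℝ}
    {β : J → ℝ} {μ : I → J → ℝ} {x : I → J → ℝ} (hx : SPPOptimal lam β μ x 1) (d : I → J → ℝ)
    (hd0 : ∀ i j, x i j = 0 → 0 ≤ d i j) (hdμ : ∀ i j, μ i j = 0 → d i j = 0)
    (hdi : ∀ i, ∑ j, d i j = 0)
    (hdj : ∀ j, ∑ i, x i j / (β j * μ i j) = 1 → ∑ i, d i j / (β j * μ i j) < 0) : False := by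
  obtain ⟨⟨hx0, hxμ, hxi, hxj⟩, hopt⟩ := hx
  have e1 : ∀ᶠ ε in nhdsWithin (0 : ℝ) (Set.Ioi 0), ∀ i j, 0 ≤ x i j + ε * d i j := by
    refine Filter.eventually_all.2 fun i => Filter.eventually_all.2 fun j => ?_
    rcases (hx0 i j).lt_or_eq with hp | h0
    · have : Filter.Tendsto (fun ε : ℝ => x i j + ε * d i j) (nhdsWithin 0 (Set.Ioi 0))
          (nhds (x i j + 0 * d i j)) :=
        (Continuous.tendsto (by fun_prop) 0).mono_left nhdsWithin_le_nhds
      filter_upwards [this.eventually (lt_mem_nhds (show 0 < x i j + 0 * d i j by simpa))]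
        with ε h using h.le
    · filter_upwards [self_mem_nhdsWithin] with ε hε
      rw [← h0, zero_add]
      exact mul_nonneg (le_of_lt hε) (hd0 i j h0.symm)
  have hsum : ∀ ε j, ∑ i, (x i j + ε * d i j) / (β j * μ i j)
      = ∑ i, x i j / (β j * μ i j) + ε * ∑ i, d i j / (β j * μ i j) := by
    intro ε j
    rw [Finset.mul_sum, ← Finset.sum_add_distrib]
    exact Finset.sum_congr rfl fun i _ => by ring
  have e2 : ∀ᶠ ε in nhdsWithin (0 : ℝ) (Set.Ioi 0), ∀ j,
      ∑ i, (x i j + ε * d i j) / (β j * μ i j) < 1 := by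
    refine Filter.eventually_all.2 fun j => ?_
    simp_rw [hsum]
    rcases (hxj j).lt_or_eq with hp | h0
    · have : Filter.Tendsto (fun ε : ℝ => ∑ i, x i j / (β j * μ i j) +
          ε * ∑ i, d i j / (β j * μ i j)) (nhdsWithin 0 (Set.Ioi 0))
          (nhds (∑ i, x i j / (β j * μ i j) + 0 * ∑ i, d i j / (β j * μ i j))) :=
        (Continuous.tendsto (by fun_prop) 0).mono_left nhdsWithin_le_nhds
      exact this.eventually (gt_mem_nhds (by simpa using hp))
    · filter_upwards [self_mem_nhdsWithin] with ε hε
      rw [h0]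
      have := mul_neg_of_pos_of_neg (show (0 : ℝ) < ε from hε) (hdj j h0)
      linarith
  obtain ⟨ε, h1, h2⟩ := (e1.and e2).exists
  -- The largest load after the perturbation is an admissible `ρ` smaller than 1.
  obtain ⟨j₁, hj₁⟩ := Finite.exists_max fun j => ∑ i, (x i j + ε * d i j) / (β j * μ i j)
  refine absurd (hopt _ _ ⟨h1, fun i j h => by simp [hxμ i j h, hdμ i j h], fun i => ?_, hj₁⟩)
    (not_le.2 (h2 j₁))
  rw [Finset.sum_add_distrib, ← Finset.mul_sum, hdi, hxi]; simp

lemma Basic.rate_pos {I J : Type*} [Fintype I] [Fintype J] {lam : I → ℝ}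
    {β : J → ℝ} {μ : I → J → ℝ} {x : I → J → ℝ} {ρ : ℝ} (hμ : ∀ i j, 0 ≤ μ i j)
    (hx : SPPFeasible lam β μ x ρ) {i : I} {j : J} (h : Basic x i j) : 0 < μ i j :=
  (hμ i j).lt_of_ne fun h0 => (ne_of_gt h) (hx.2.1 i j h0.symm)

section PoolRates

lemma sum_div_eq_of_poolRates {I J : Type*} [Fintype I] {β : J → ℝ} {μ : I → J → ℝ}
    {x : I → J → ℝ} {m : J → ℝ} (hm : ∀ i j, Basic x i j → μ i j = m j)
    {d : I → J → ℝ} (hd : ∀ i j, ¬ Basic x i j → d i j = 0) (j : J) :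
    ∑ i, d i j / (β j * μ i j) = (∑ i, d i j) / (β j * m j) := by
  rw [Finset.sum_div]
  refine Finset.sum_congr rfl fun i _ => ?_
  by_cases h : Basic x i j
  · rw [hm i j h]
  · simp [hd i j h]

variable {I J : Type*} [Fintype I] [Fintype J] [Nonempty J] {lam : I → ℝ}
  {β : J → ℝ} {μ : I → J → ℝ} {x : I → J → ℝ} {m : J → ℝ}

/-- All pools are critically loaded. -/
lemma sum_flow_eq_capacity (hβ : ∀ j, 0 < β j)
    (hx : SPPOptimal lam β μ x 1)
    (hE : (activityGraph (Basic x)).Connected) (hm : ∀ i j, Basic x i j → μ i j = m j)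
    (hm0 : ∀ j, 0 < m j) (j : J) : ∑ i, x i j = β j * m j := by
  classical
  have hoff : ∀ i j, ¬ Basic x i j → x i j = 0 := fun i j h =>
    le_antisymm (not_lt.1 h) (hx.1.1 i j)
  have hpos : 0 < β j * m j := mul_pos (hβ j) (hm0 j)
  by_contra hne
  have hload : ∑ i, x i j / (β j * μ i j) ≠ 1 := by
    rw [sum_div_eq_of_poolRates hm hoff]
    rwa [ne_eq, div_eq_one_iff_eq hpos.ne']
  -- A pool with slack could take over work from all others: every pool gives up one unit and `j`
  -- receives all of them.
  obtain ⟨d, d0, d1, d2⟩ := exists_flow hE (fun _ => 0)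
    (fun k => (if k = j then (Fintype.card J : ℝ) else 0) - 1) (by simp)
  refine hx.no_improvement d (fun i j h => ?_) (fun i j h => ?_) d1 fun k hk => ?_
  · exact (d0 i j (by simp [Basic, h])).ge
  · exact d0 i j (by simp [Basic, hx.1.2.1 i j h])
  · rw [sum_div_eq_of_poolRates hm d0, d2, if_neg (by rintro rfl; exact hload hk)]
    exact div_neg_of_neg_of_pos (by norm_num) (mul_pos (hβ k) (hm0 k))

/-- Non-basic activities are not faster than basic ones. -/
lemma rate_le_poolRate (hβ : ∀ j, 0 < β j)
    (hx : SPPOptimal lam β μ x 1)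
    (hE : (activityGraph (Basic x)).Connected) (hm : ∀ i j, Basic x i j → μ i j = m j)
    (hm0 : ∀ j, 0 < m j) (i : I) (j : J) : μ i j ≤ m j := by
  classical
  by_contra! hlt
  have hμp : 0 < μ i j := (hm0 j).trans hlt
  have hcard : (0 : ℝ) < Fintype.card J := by exact_mod_cast Fintype.card_pos
  obtain ⟨ε, hε, hε'⟩ : ∃ ε : ℝ, 0 < ε ∧ Fintype.card J * ε < 1 - m j / μ i j := by
    have h1 : 0 < 1 - m j / μ i j := by rw [sub_pos, div_lt_one hμp]; exact hlt
    refine ⟨(1 - m j / μ i j) / 2 / Fintype.card J, by positivity, ?_⟩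
    rw [mul_div_cancel₀ _ hcard.ne']; linarith
  -- One unit of class `i` is withdrawn from the tree and later put on the faster activity `(i, j)`.
  -- In units of `1 / (β j * m j)` it then costs pool `j` only `m j / μ i j < 1`, and the saving is
  -- spread so that every load falls.
  obtain ⟨d, d0, d1, d2⟩ := exists_flow hE (fun k => if k = i then -1 else 0)
    (fun k => (if k = j then Fintype.card J * ε - 1 else 0) - ε) (by simp)
  have hsplit : ∀ k, ∑ i', (d i' k + if i' = i ∧ k = j then 1 else 0) / (β k * μ i' k)
      = (∑ i', d i' k) / (β k * m k) + if k = j then 1 / (β j * μ i j) else 0 := by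
    intro k
    simp_rw [add_div]
    rw [Finset.sum_add_distrib, sum_div_eq_of_poolRates hm d0]
    congr 1
    by_cases hk : k = j
    · subst hk
      rw [Finset.sum_eq_single i] <;> simp +contextual
    · simp [hk]
  refine hx.no_improvement (fun i' j' => d i' j' + if i' = i ∧ j' = j then 1 else 0)
    (fun i' j' h => ?_) (fun i' j' h => ?_) (fun i' => ?_) fun k _ => ?_
  · rw [d0 i' j' (by simp [Basic, h])]; split_ifs <;> norm_num
  · rw [d0 i' j' (by simp [Basic, hx.1.2.1 i' j' h]), if_neg, add_zero]
    rintro ⟨rfl, rfl⟩; exact hμp.ne' h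
  · rw [Finset.sum_add_distrib, d1]
    by_cases h : i' = i <;> simp [h]
  · rw [hsplit, d2]
    have hβk := hβ k
    have hmk := hm0 k
    by_cases hk : k = j
    · subst hk
      rw [if_pos rfl, if_pos rfl]
      have : (Fintype.card J * ε - 1 - ε) / (β k * m k) + 1 / (β k * μ i k)
          = (Fintype.card J * ε - 1 - ε + m k / μ i k) / (β k * m k) := by
        field_simp
      rw [this]
      refine div_neg_of_neg_of_pos ?_ (by positivity)
      linarith
    · rw [if_neg hk, if_neg hk, add_zero]
      exact div_neg_of_neg_of_pos (by linarith) (by positivity)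

/-- When the service rates of the basic activities depend on the pool only, the optimal dual prices
of all classes agree. -/
lemma dual_price_eq (hβ : ∀ j, 0 < β j)
    (hx : SPPOptimal lam β μ x 1) (hE : (activityGraph (Basic x)).Connected)
    (hm : ∀ i j, Basic x i j → μ i j = m j) (hm0 : ∀ j, 0 < m j)
    {ν : I → ℝ} {α : J → ℝ} (hd : DualOptimal lam β μ ν α) (i : I) :
    ν i * ∑ k, lam k = 1 := by
  have hcap := sum_flow_eq_capacity hβ hx hE hm hm0
  have htot : ∑ k, lam k = ∑ j, β j * m j := by
    simp_rw [← hcap, ← hx.1.2.2.1]; exact Finset.sum_comm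
  have hpos : 0 < ∑ k, lam k := by
    rw [htot]
    exact Finset.sum_pos (fun j _ => mul_pos (hβ j) (hm0 j)) Finset.univ_nonempty
  obtain ⟨⟨hα0, hα1, hαν⟩, hopt⟩ := hd
  -- Constant class prices are dual feasible because no activity is faster than the basic rate of
  -- its pool.
  have hge : 1 ≤ ∑ i, lam i * ν i := by
    have := hopt (fun _ => 1 / ∑ k, lam k) (fun j => β j * m j / ∑ k, lam k)
      ⟨fun j => div_nonneg (mul_nonneg (hβ j).le (hm0 j).le) hpos.le, by
        rw [← Finset.sum_div, ← htot, div_self hpos.ne'], fun i j => by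
        rw [one_div, ← div_eq_inv_mul]
        have := rate_le_poolRate hβ hx hE hm hm0 i j
        exact div_le_div_of_nonneg_right (mul_le_mul_of_nonneg_left this (hβ j).le) hpos.le⟩
    rw [← Finset.sum_mul, mul_one_div_cancel hpos.ne'] at this
    exact this
  have hterm : ∀ i j, 0 ≤ x i j * (α j / (β j * m j) - ν i) := by
    intro i j
    rcases (hx.1.1 i j).lt_or_eq with hp | h0
    · refine mul_nonneg hp.le (sub_nonneg.2 ?_)
      rw [le_div_iff₀ (mul_pos (hβ j) (hm0 j)), ← hm i j hp]
      exact hαν i j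
    · simp [← h0]
  -- Complementary slackness: these nonnegative terms add up to at most zero, so the dual constraint
  -- is tight on every basic activity.
  have hsum : ∑ i, ∑ j, x i j * (α j / (β j * m j) - ν i) = 1 - ∑ i, lam i * ν i := by
    simp_rw [mul_sub, Finset.sum_sub_distrib]
    congr 1
    · rw [Finset.sum_comm, ← hα1]
      refine Finset.sum_congr rfl fun j _ => ?_
      rw [← Finset.sum_mul, hcap, mul_div_cancel₀ _ (mul_pos (hβ j) (hm0 j)).ne']
    · refine Finset.sum_congr rfl fun i _ => ?_
      rw [← Finset.sum_mul, hx.1.2.2.1]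
  have hz : ∑ i, ∑ j, x i j * (α j / (β j * m j) - ν i) = 0 :=
    le_antisymm (by linarith)
      (Finset.sum_nonneg fun i _ => Finset.sum_nonneg fun j _ => hterm i j)
  have hedge : ∀ i j, Basic x i j → ν i = α j / (β j * m j) := by
    intro i j hij
    have h1 := (Finset.sum_eq_zero_iff_of_nonneg fun i _ =>
      Finset.sum_nonneg fun j _ => hterm i j).1 hz i (Finset.mem_univ i)
    have h2 := (Finset.sum_eq_zero_iff_of_nonneg fun j _ => hterm i j).1 h1 j (Finset.mem_univ j)
    rcases mul_eq_zero.1 h2 with h | h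
    · exact absurd h (ne_of_gt hij)
    · linarith
  have hconst := eq_of_connected hE hedge
  rw [htot, ← hα1, Finset.mul_sum]
  refine Finset.sum_congr rfl fun j _ => ?_
  have := hconst (Sum.inl i) (Sum.inr j)
  simp only [Sum.elim_inl, Sum.elim_inr] at this
  rw [this, div_mul_cancel₀ _ (mul_pos (hβ j) (hm0 j)).ne']

end PoolRates

/-! ### Drift criterion for stationary laws of Markov jump processes -/

open scoped ENNReal in
/-- Foster–Lyapunov moment bound: if `p` is invariant for the jump rates `R`, which are bounded on
the support of `p`, and the drift of `V` is at most `b - W` there, then the mean of `W` is at most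
`b`. No integrability of `V` is required. -/
lemma tsum_le_of_drift {S : Type*} (p : PMF S) (R : S → S → ℝ≥0∞)
    (hbal : ∀ t, p t * ∑' u, R t u = ∑' s, p s * R s t) {Q : ℝ≥0∞} (hQ : Q ≠ ⊤)
    (hR : ∀ s, p s ≠ 0 → ∑' t, R s t ≤ Q) (V W : S → ℝ≥0∞) (b : ℝ≥0∞)
    (hV : ∀ s, V s ≠ ⊤)
    (hdrift : ∀ s, p s ≠ 0 → ∑' t, R s t * V t + W s ≤ (∑' t, R s t) * V s + b) :
    ∑' s, p s * W s ≤ b := by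
  classical
  -- Truncating `V` at `k` makes the stationary means finite, so that they can be cancelled in the
  -- balance identity.
  have trunc : ∀ k : ℕ, ∑' s, p s * (if V s < k then W s else 0) ≤ b := by
    intro k
    have hinv : ∑' s, p s * ∑' t, R s t * min (V t) k
        = ∑' s, p s * ((∑' t, R s t) * min (V s) k) := by
      simp_rw [← mul_assoc, hbal, ← ENNReal.tsum_mul_right, ← ENNReal.tsum_mul_left]
      rw [ENNReal.tsum_comm]
      simp_rw [mul_assoc]
    have hfin : ∑' s, p s * ((∑' t, R s t) * min (V s) k) ≠ ⊤ := by
      have : ∑' s, p s * ((∑' t, R s t) * min (V s) k) ≤ ∑' s, p s * (Q * k) := by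
        refine ENNReal.tsum_le_tsum fun s => ?_
        by_cases h : p s = 0
        · simp [h]
        · exact mul_le_mul_right (mul_le_mul' (hR s h) (min_le_right _ _)) _
      refine ne_top_of_le_ne_top ?_ this
      rw [ENNReal.tsum_mul_right, p.tsum_coe, one_mul]
      exact ENNReal.mul_ne_top hQ (ENNReal.natCast_ne_top k)
    have hstep : ∀ s, p s * ∑' t, R s t * min (V t) k + p s * (if V s < k then W s else 0)
        ≤ p s * ((∑' t, R s t) * min (V s) k) + p s * b := by
      intro s
      by_cases h : p s = 0
      · simp [h]
      rw [← mul_add, ← mul_add]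
      refine mul_le_mul_right ?_ _
      -- Below level `k` the truncation inherits the drift bound of `V`; at or above it the
      -- truncation cannot increase.
      split_ifs with hk
      · rw [min_eq_left hk.le]
        refine le_trans ?_ (hdrift s h)
        gcongr
        exact min_le_left _ _
      · rw [min_eq_right (not_lt.1 hk), add_zero, ← ENNReal.tsum_mul_right]
        refine le_trans (ENNReal.tsum_le_tsum fun t => ?_) le_self_add
        gcongr
        exact min_le_right _ _
    have htot := ENNReal.tsum_le_tsum hstep
    rw [ENNReal.tsum_add, ENNReal.tsum_add, hinv, ENNReal.tsum_mul_right, p.tsum_coe, one_mul]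
      at htot
    exact (ENNReal.add_le_add_iff_left hfin).1 htot
  rw [ENNReal.tsum_eq_iSup_sum]
  refine iSup_le fun A => ?_
  obtain ⟨k, hk⟩ : ∃ k : ℕ, ∀ s ∈ A, V s < k := by
    choose g hg using fun s => ENNReal.exists_nat_gt (hV s)
    refine ⟨A.sup g, fun s hs => (hg s).trans_le ?_⟩
    exact_mod_cast Finset.le_sup (f := g) hs
  calc ∑ s ∈ A, p s * W s = ∑ s ∈ A, p s * (if V s < k then W s else 0) :=
        Finset.sum_congr rfl fun s hs => by rw [if_pos (hk s hs)]
    _ ≤ ∑' s, p s * (if V s < k then W s else 0) := ENNReal.sum_le_tsum A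
    _ ≤ b := trunc k

open scoped ENNReal in
lemma tsum_mul_le_of_support {S : Type*} (q : PMF S) (f : S → ℝ≥0∞) (c : ℝ≥0∞)
    (h : ∀ t ∈ q.support, f t ≤ c) : ∑' t, q t * f t ≤ c := by
  calc ∑' t, q t * f t ≤ ∑' t, q t * c := by
        refine ENNReal.tsum_le_tsum fun t => ?_
        by_cases ht : q t = 0
        · simp [ht]
        · exact mul_le_mul_right (h t ((PMF.mem_support_iff _ _).2 ht)) _
    _ = c := by rw [ENNReal.tsum_mul_right, q.tsum_coe, one_mul]

section Chain

variable {I J : Type*} [Fintype I] [Fintype J] [DecidableEq I] [DecidableEq J]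
  {E : I → J → Prop} {β : J → ℝ} {N : J → ℕ}

lemma tsum_rate_mul (P : Policy E β N) (a : I → ℝ) (μ : I → J → ℝ) (s : State I J)
    (f : State I J → ENNReal) :
    ∑' t, rate P a μ s t * f t = ∑ i, ENNReal.ofReal (a i) * ∑' t, afterArrival P s i t * f t +
      ∑ i, ∑ j, ENNReal.ofReal (μ i j * s.busy i j) * ∑' t, afterService P s i j t * f t := by
  simp_rw [rate, add_mul, Finset.sum_mul]
  rw [ENNReal.tsum_add, Summable.tsum_finsetSum fun _ _ => ENNReal.summable,
    Summable.tsum_finsetSum fun _ _ => ENNReal.summable]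
  congr 1
  · simp_rw [mul_assoc, ENNReal.tsum_mul_left]
  · refine Finset.sum_congr rfl fun i _ => ?_
    rw [Summable.tsum_finsetSum fun _ _ => ENNReal.summable]
    simp_rw [mul_assoc, ENNReal.tsum_mul_left]

lemma tsum_rate (P : Policy E β N) (a : I → ℝ) (μ : I → J → ℝ) (s : State I J) :
    ∑' t, rate P a μ s t = ∑ i, ENNReal.ofReal (a i) +
      ∑ i, ∑ j, ENNReal.ofReal (μ i j * s.busy i j) := by
  simpa using tsum_rate_mul P a μ s fun _ => 1

/-- Drift criterion for the stationary laws of the system. -/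
lemma IsStationary.expect_le {P : Policy E β N} {a : I → ℝ} {μ : I → J → ℝ}
    {p : PMF (State I J)} (hp : IsStationary P a μ p) (ha : ∀ i, 0 ≤ a i)
    (hμ : ∀ i j, 0 ≤ μ i j) (F : State I J → ℝ) (hF : ∀ s, 0 ≤ F s) {c b : ℝ} (hc : 0 < c)
    (hb : 0 ≤ b)
    (hdrift : ∀ s, Admissible E N s → ∃ (δ : I → ℝ) (ε : I → J → ℝ),
      (∀ i, ∀ t ∈ (afterArrival P s i).support, F t ≤ F s + δ i) ∧
      (∀ i j, 0 < s.busy i j → ∀ t ∈ (afterService P s i j).support, F t ≤ F s + ε i j) ∧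
      ∑ i, a i * δ i + ∑ i, ∑ j, μ i j * s.busy i j * ε i j ≤ b - c * F s) :
    expect p F ≤ ENNReal.ofReal (b / c) := by
  have hmain : ∑' s, p s * ENNReal.ofReal (c * F s) ≤ ENNReal.ofReal b := by
    refine tsum_le_of_drift p (rate P a μ) hp.2
      (Q := ∑ i, ENNReal.ofReal (a i) + ∑ i, ∑ j, ENNReal.ofReal (μ i j * N j))
      (by simp [ENNReal.sum_eq_top]) ?_ (fun s => ENNReal.ofReal (F s)) _ _
      (fun _ => ENNReal.ofReal_ne_top) ?_
    · intro s hs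
      rw [tsum_rate]
      gcongr with i _ j _
      · exact hμ i j
      · exact (Finset.single_le_sum (f := fun i => s.busy i j) (fun _ _ => Nat.zero_le _)
          (Finset.mem_univ i)).trans ((hp.1 s hs).2.1 j)
    · intro s hs
      obtain ⟨δ, ε, hδ, hε, hsum⟩ := hdrift s (hp.1 s hs)
      -- The support of a `PMF` is nonempty, so the upper bounds on `F` after a jump are nonnegative
      -- and pass through `ENNReal.ofReal`.
      have hδ0 : ∀ i, 0 ≤ F s + δ i := fun i => by
        obtain ⟨t, ht⟩ := (afterArrival P s i).support_nonempty
        exact (hF t).trans (hδ i t ht)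
      have hε0 : ∀ i j, 0 ≤ μ i j * s.busy i j * (F s + ε i j) := fun i j => by
        rcases Nat.eq_zero_or_pos (s.busy i j) with h | h
        · simp [h]
        obtain ⟨t, ht⟩ := (afterService P s i j).support_nonempty
        exact mul_nonneg (mul_nonneg (hμ i j) (Nat.cast_nonneg _))
          ((hF t).trans (hε i j h t ht))
      have hμb : ∀ i j, 0 ≤ μ i j * s.busy i j := fun i j =>
        mul_nonneg (hμ i j) (Nat.cast_nonneg _)
      have hA : ∑ i, ENNReal.ofReal (a i) * ∑' t, afterArrival P s i t * ENNReal.ofReal (F t)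
          ≤ ENNReal.ofReal (∑ i, a i * (F s + δ i)) := by
        rw [ENNReal.ofReal_sum_of_nonneg fun i _ => mul_nonneg (ha i) (hδ0 i)]
        refine Finset.sum_le_sum fun i _ => ?_
        rw [ENNReal.ofReal_mul (ha i)]
        gcongr
        exact tsum_mul_le_of_support _ _ _ fun t ht => ENNReal.ofReal_le_ofReal (hδ i t ht)
      have hB : ∑ i, ∑ j, ENNReal.ofReal (μ i j * s.busy i j) *
            ∑' t, afterService P s i j t * ENNReal.ofReal (F t)
          ≤ ENNReal.ofReal (∑ i, ∑ j, μ i j * s.busy i j * (F s + ε i j)) := by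
        rw [ENNReal.ofReal_sum_of_nonneg fun i _ => Finset.sum_nonneg fun j _ => hε0 i j]
        refine Finset.sum_le_sum fun i _ => ?_
        rw [ENNReal.ofReal_sum_of_nonneg fun j _ => hε0 i j]
        refine Finset.sum_le_sum fun j _ => ?_
        rcases Nat.eq_zero_or_pos (s.busy i j) with h | h
        · simp [h]
        rw [ENNReal.ofReal_mul (hμb i j)]
        gcongr
        exact tsum_mul_le_of_support _ _ _ fun t ht => ENNReal.ofReal_le_ofReal (hε i j h t ht)
      have hq : ∑' t, rate P a μ s t
          = ENNReal.ofReal (∑ i, a i + ∑ i, ∑ j, μ i j * s.busy i j) := by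
        rw [tsum_rate, ENNReal.ofReal_add (Finset.sum_nonneg fun i _ => ha i)
          (Finset.sum_nonneg fun i _ => Finset.sum_nonneg fun j _ => hμb i j),
          ENNReal.ofReal_sum_of_nonneg fun i _ => ha i,
          ENNReal.ofReal_sum_of_nonneg fun i _ => Finset.sum_nonneg fun j _ => hμb i j]
        congr 1
        exact Finset.sum_congr rfl fun i _ =>
          (ENNReal.ofReal_sum_of_nonneg fun j _ => hμb i j).symm
      have hq0 : 0 ≤ ∑ i, a i + ∑ i, ∑ j, μ i j * s.busy i j :=
        add_nonneg (Finset.sum_nonneg fun i _ => ha i)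
          (Finset.sum_nonneg fun i _ => Finset.sum_nonneg fun j _ => hμb i j)
      have hA0 : 0 ≤ ∑ i, a i * (F s + δ i) :=
        Finset.sum_nonneg fun i _ => mul_nonneg (ha i) (hδ0 i)
      have hB0 : 0 ≤ ∑ i, ∑ j, μ i j * s.busy i j * (F s + ε i j) :=
        Finset.sum_nonneg fun i _ => Finset.sum_nonneg fun j _ => hε0 i j
      rw [tsum_rate_mul, hq, ← ENNReal.ofReal_mul hq0,
        ← ENNReal.ofReal_add (mul_nonneg hq0 (hF s)) hb]
      refine (add_le_add_left (add_le_add hA hB) _).trans ?_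
      rw [← ENNReal.ofReal_add hA0 hB0,
        ← ENNReal.ofReal_add (add_nonneg hA0 hB0) (mul_nonneg hc.le (hF s))]
      refine ENNReal.ofReal_le_ofReal ?_
      have e1 : ∑ i, a i * (F s + δ i) = (∑ i, a i) * F s + ∑ i, a i * δ i := by
        simp_rw [mul_add, Finset.sum_add_distrib, Finset.sum_mul]
      have e2 : ∑ i, ∑ j, μ i j * s.busy i j * (F s + ε i j)
          = (∑ i, ∑ j, μ i j * s.busy i j) * F s + ∑ i, ∑ j, μ i j * s.busy i j * ε i j := by
        simp_rw [mul_add, Finset.sum_add_distrib, Finset.sum_mul]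
      rw [e1, e2]
      linarith
  have hc' : ENNReal.ofReal c ≠ 0 := by simpa using hc
  rw [ENNReal.ofReal_div_of_pos hc, ENNReal.le_div_iff_mul_le (Or.inl hc')
    (Or.inl ENNReal.ofReal_ne_top), expect, ← ENNReal.tsum_mul_right]
  refine le_trans (le_of_eq (tsum_congr fun s => ?_)) hmain
  rw [ENNReal.ofReal_mul hc.le, mul_assoc, mul_comm (ENNReal.ofReal (F s))]

end Chain

/-! ### One transition -/

/-- The excess `κ - 1 / 2` absorbs the cubic remainder near 0. Having `κ` arbitrarily close to `1 /
2` is what allows every exponent up to `C`. -/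
lemma exists_exp_le_quadratic {κ : ℝ} (hκ : 1 / 2 < κ) :
    ∃ η, 0 < η ∧ ∀ y : ℝ, |y| ≤ η → Real.exp y ≤ 1 + y + κ * y ^ 2 := by
  refine ⟨min 1 (κ - 1 / 2), lt_min one_pos (by linarith), fun y hy => ?_⟩
  have h1 : |y| ≤ 1 := hy.trans (min_le_left _ _)
  have h2 : |y| ≤ κ - 1 / 2 := hy.trans (min_le_right _ _)
  have h := (abs_le.1 (Real.exp_bound h1 (n := 3) (by norm_num))).2
  simp only [Finset.sum_range_succ, Finset.sum_range_zero, Nat.factorial] at h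
  norm_num at h
  have h3 : |y| ^ 3 ≤ (κ - 1 / 2) * y ^ 2 := by
    rw [pow_succ, sq_abs, mul_comm]
    exact mul_le_mul_of_nonneg_right h2 (sq_nonneg y)
  have h4 : 0 ≤ |y| ^ 3 := by positivity
  linarith

lemma scaledQueue_nonneg {I J : Type*} (r : ℝ) (s : State I J) (i : I) : 0 ≤ scaledQueue r s i :=
  div_nonneg (Nat.cast_nonneg _) (Real.sqrt_nonneg _)

lemma scaledQueue_mono {I J : Type*} {r : ℝ} {s : State I J} {i k : I} (h : s.queue i ≤ s.queue k) :
    scaledQueue r s i ≤ scaledQueue r s k := by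
  unfold scaledQueue
  gcongr

/-- The increment of `exp (θ * q)` when `q` increases by `d`. -/
lemma exp_increment_le {κ η q d c : ℝ} (hη : ∀ y : ℝ, |y| ≤ η → Real.exp y ≤ 1 + y + κ * y ^ 2)
    {θ : ℝ} (h : |θ * d| ≤ η) (hc : 0 ≤ c) :
    c * Real.exp (θ * q) * (Real.exp (θ * d) - 1)
      ≤ Real.exp (θ * q) * (θ * (c * d) + κ * θ ^ 2 * (c * d ^ 2)) := by
  have h1 : Real.exp (θ * d) - 1 ≤ θ * d + κ * (θ * d) ^ 2 := by linarith [hη _ h]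
  calc c * Real.exp (θ * q) * (Real.exp (θ * d) - 1)
      ≤ c * Real.exp (θ * q) * (θ * d + κ * (θ * d) ^ 2) :=
        mul_le_mul_of_nonneg_left h1 (mul_nonneg hc (Real.exp_pos _).le)
    _ = _ := by ring

/-! ### Scaled loads and the levels at which the policy acts. -/

section Loads

variable {I J : Type*} [Fintype I]

/-- Scaled deviation of the load of pool `j` from full occupation. -/
noncomputable def scaledLoad (β : J → ℝ) (r : ℝ) (s : State I J) (j : J) : ℝ := scaledIdle β r s j / β j

lemma scaledLoad_le_scaledLoad {β : J → ℝ} (hβ : ∀ j, 0 < β j) {r : ℝ} {s : State I J}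
    {j j' : J} (h : load β s j ≤ load β s j') : scaledLoad β r s j ≤ scaledLoad β r s j' := by
  have e : ∀ j, scaledLoad β r s j = (load β s j - r) / √r := fun j => by
    have := (hβ j).ne'
    rw [scaledLoad, scaledIdle, load, div_right_comm, sub_div, mul_div_cancel_right₀ _ this]
  rw [e, e]
  gcongr

lemma Admissible.scaledLoad_nonpos {E : I → J → Prop} {N : J → ℕ} {s : State I J}
    (hs : Admissible E N s) {β : J → ℝ} (hβ : ∀ j, 0 < β j) {r : ℝ}
    (hN : ∀ j, (N j : ℝ) = r * β j) (j : J) : scaledLoad β r s j ≤ 0 := by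
  refine div_nonpos_of_nonpos_of_nonneg (div_nonpos_of_nonpos_of_nonneg ?_ (Real.sqrt_nonneg _))
    (hβ j).le
  rw [← hN, sub_nonpos]
  exact_mod_cast hs.2.1 j

lemma total_eq_of_scaledLoad_eq_zero {N : J → ℕ} {s : State I J} {β : J → ℝ} (hβ : ∀ j, 0 < β j)
    {r : ℝ} (hr : 0 < r) (hN : ∀ j, (N j : ℝ) = r * β j) {j : J} :
    scaledLoad β r s j = 0 ↔ s.total j = N j := by
  have h1 := (hβ j).ne'
  have h2 := (Real.sqrt_pos.2 hr).ne'
  rw [scaledLoad, scaledIdle, div_eq_zero_iff, div_eq_zero_iff, ← hN, sub_eq_zero]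
  simp [h1, h2]

lemma expFunctional_eq [Fintype J] (β : J → ℝ) (r θ : ℝ) (s : State I J) :
    expFunctional β r θ s = ∑ i, Real.exp (θ * scaledQueue r s i) +
      ∑ j, β j * Real.exp (θ * scaledLoad β r s j) := by
  simp_rw [expFunctional, scaledLoad, mul_div_assoc]

lemma expFunctional_of_queue [Fintype J] {β : J → ℝ} {r θ : ℝ} {s t : State I J} {k : I} {d : ℝ}
    (hk : scaledQueue r t k = scaledQueue r s k + d)
    (hq : ∀ i, i ≠ k → t.queue i = s.queue i) (ht : ∀ j, t.total j = s.total j) :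
    expFunctional β r θ t = expFunctional β r θ s +
      Real.exp (θ * scaledQueue r s k) * (Real.exp (θ * d) - 1) := by
  classical
  have hZ : ∀ j, scaledLoad β r t j = scaledLoad β r s j := fun j => by
    simp [scaledLoad, scaledIdle, ht]
  have hQ : ∀ i, i ≠ k → scaledQueue r t i = scaledQueue r s i := fun i h => by
    simp [scaledQueue, hq i h]
  simp_rw [expFunctional_eq, hZ]
  rw [← Finset.add_sum_erase _ _ (Finset.mem_univ k),
    ← Finset.add_sum_erase _ (fun i => Real.exp (θ * scaledQueue r s i)) (Finset.mem_univ k),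
    Finset.sum_congr rfl fun i hi => by rw [hQ i (Finset.ne_of_mem_erase hi)], hk, mul_add,
    Real.exp_add]
  ring

lemma expFunctional_of_total [Fintype J] {β : J → ℝ} {r θ : ℝ} {s t : State I J} {k : J} {d : ℝ}
    (hk : scaledLoad β r t k = scaledLoad β r s k + d)
    (ht : ∀ j, j ≠ k → t.total j = s.total j) (hq : ∀ i, t.queue i = s.queue i) :
    expFunctional β r θ t = expFunctional β r θ s +
      β k * Real.exp (θ * scaledLoad β r s k) * (Real.exp (θ * d) - 1) := by
  classical
  have hQ : ∀ i, scaledQueue r t i = scaledQueue r s i := fun i => by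
    simp [scaledQueue, hq]
  have hZ : ∀ j, j ≠ k → scaledLoad β r t j = scaledLoad β r s j := fun j h => by
    simp [scaledLoad, scaledIdle, ht j h]
  simp_rw [expFunctional_eq, hQ]
  rw [← Finset.add_sum_erase _ (fun j => β j * Real.exp (θ * scaledLoad β r t j))
      (Finset.mem_univ k),
    ← Finset.add_sum_erase _ (fun j => β j * Real.exp (θ * scaledLoad β r s j))
      (Finset.mem_univ k),
    Finset.sum_congr rfl fun j (hj : j ∈ Finset.univ.erase k) => by
      rw [hZ j (Finset.ne_of_mem_erase hj)], hk, mul_add, Real.exp_add]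
  ring

/-- The levels at which an LQFS-LB policy acts: an arrival of class `i` happens at level `y i`
(of its queue, or of the least loaded compatible pools) and a service completion of pool `j` at
level `w j` (of the longest compatible queue, or of the pool). -/
structure ActionLevels {E : I → J → Prop} {β : J → ℝ} {N : J → ℕ} (P : Policy E β N) (r : ℝ)
    (s : State I J) where
  y : I → ℝ
  w : J → ℝ
  y_le_w : ∀ i j, E i j → y i ≤ w j
  y_of_idle : ∀ i, SeesIdle E N s i → (∃ j, y i = scaledLoad β r s j) ∧
    ∀ j ∈ (P.route s i).support, scaledLoad β r s j = y i
  y_of_not_idle : ∀ i, ¬ SeesIdle E N s i → y i = scaledQueue r s i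
  w_of_waiting : ∀ j, SeesWaiting E s j → ∀ i, ∀ k ∈ (P.sched s i j).support,
    0 < s.queue k ∧ scaledQueue r s k = w j
  w_of_not_waiting : ∀ j, ¬ SeesWaiting E s j → w j = scaledLoad β r s j
  queue_le : ∀ i j, E i j → 0 < s.queue i → scaledQueue r s i ≤ w j
  w_nonneg_of_waiting : ∀ j, SeesWaiting E s j → 0 ≤ w j

/-- Ties do not matter because all choices in the support of the policy have the same level. The
inequality `y i ≤ w j` combines the two greedy rules with the nonpositivity of loads and
nonnegativity of queues. -/
lemma exists_actionLevels {E : I → J → Prop} {β : J → ℝ} (hβ : ∀ j, 0 < β j) {N : J → ℕ}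
    (P : Policy E β N) {r : ℝ} (hr : 0 < r) (hN : ∀ j, (N j : ℝ) = r * β j) {s : State I J}
    (hs : Admissible E N s) : Nonempty (ActionLevels P r s) := by
  have hz := hs.scaledLoad_nonpos hβ hN
  have hy : ∀ i, ∃ y : ℝ, (SeesIdle E N s i → (∃ j, y = scaledLoad β r s j) ∧
      (∀ j, E i j → y ≤ scaledLoad β r s j) ∧
      ∀ j ∈ (P.route s i).support, scaledLoad β r s j = y) ∧
      (¬ SeesIdle E N s i → y = scaledQueue r s i) := by
    intro i
    by_cases h : SeesIdle E N s i
    · obtain ⟨j, hj⟩ := (P.route s i).support_nonempty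
      have h1 := P.route_mem s i h
      refine ⟨scaledLoad β r s j, fun _ => ⟨⟨j, rfl⟩,
        fun j' hj' => scaledLoad_le_scaledLoad hβ ((h1 j hj).2 j' hj'), fun j' hj' => ?_⟩,
        fun h' => absurd h h'⟩
      exact le_antisymm (scaledLoad_le_scaledLoad hβ ((h1 j' hj').2 j (h1 j hj).1))
        (scaledLoad_le_scaledLoad hβ ((h1 j hj).2 j' (h1 j' hj').1))
    · exact ⟨_, fun h' => absurd h' h, fun _ => rfl⟩
  have hw : ∀ j, ∃ w : ℝ, (SeesWaiting E s j → 0 ≤ w ∧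
      (∀ k, E k j → scaledQueue r s k ≤ w) ∧ ∀ i, ∀ k ∈ (P.sched s i j).support,
      0 < s.queue k ∧ scaledQueue r s k = w) ∧
      (¬ SeesWaiting E s j → w = scaledLoad β r s j) := by
    intro j
    by_cases h : SeesWaiting E s j
    · obtain ⟨i₀, hi₀, hq₀⟩ := id h
      obtain ⟨k₀, hk₀⟩ := (P.sched s i₀ j).support_nonempty
      have h0 := P.sched_mem s i₀ j h k₀ hk₀
      refine ⟨scaledQueue r s k₀, fun _ => ⟨scaledQueue_nonneg r s k₀,
        fun k hk => scaledQueue_mono (h0.2 k hk), fun i k hk => ?_⟩, fun h' => absurd h h'⟩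
      have h1 := P.sched_mem s i j h k hk
      exact ⟨hq₀.trans_le (h1.2 i₀ hi₀),
        le_antisymm (scaledQueue_mono (h0.2 k h1.1)) (scaledQueue_mono (h1.2 k₀ h0.1))⟩
    · exact ⟨_, fun h' => absurd h' h, fun _ => rfl⟩
  choose y hy1 hy2 using hy
  choose w hw1 hw2 using hw
  refine ⟨⟨y, w, fun i j hij => ?_, fun i h => ⟨(hy1 i h).1, (hy1 i h).2.2⟩, hy2,
    fun j h => (hw1 j h).2.2, hw2, fun i j hij hq => (hw1 j ⟨i, hij, hq⟩).2.1 i hij,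
    fun j h => (hw1 j h).1⟩⟩
  by_cases hi : SeesIdle E N s i
  · refine ((hy1 i hi).2.1 j hij).trans ?_
    by_cases hj : SeesWaiting E s j
    · exact (hz j).trans (hw1 j hj).1
    · exact (hw2 j hj).ge
  · rw [hy2 i hi]
    by_cases hj : SeesWaiting E s j
    · exact (hw1 j hj).2.1 i hij
    -- Class `i` sees no idle server and pool `j` sees no queue: pool `j` is full, queue `i` is
    -- empty, and both levels are 0.
    · have hq : s.queue i = 0 := by
        by_contra hne
        exact hj ⟨i, hij, Nat.pos_of_ne_zero hne⟩
      have hfull : s.total j = N j := by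
        by_contra hne
        exact hi ⟨j, hij, lt_of_le_of_ne (hs.2.1 j) hne⟩
      rw [hw2 j hj, (total_eq_of_scaledLoad_eq_zero hβ hr hN).2 hfull, scaledQueue, hq]
      simp

end Loads

/-! ### Increments of the exponential functional at single events. -/

section Transitions

variable {I J : Type*} [Fintype I] [DecidableEq I] [DecidableEq J]

lemma State.total_start (s : State I J) (i : I) (j j' : J) :
    (s.start i j).total j' = s.total j' + if j' = j then 1 else 0 := by
  have : ∀ i', (s.start i j).busy i' j'
      = s.busy i' j' + if i' = i then (if j' = j then 1 else 0) else 0 := by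
    intro i'
    by_cases hi : i' = i
    · subst hi
      by_cases hj : j' = j
      · subst hj; simp [State.start]
      · simp [State.start, hj]
    · simp [State.start, hi]
  simp only [State.total, this, Finset.sum_add_distrib, Finset.sum_ite_eq', Finset.mem_univ, if_true]

lemma State.total_complete (s : State I J) {i : I} {j : J} (h : 0 < s.busy i j) (j' : J) :
    (s.complete i j).total j' + (if j' = j then 1 else 0) = s.total j' := by
  have : ∀ i', (s.complete i j).busy i' j' + (if i' = i then (if j' = j then 1 else 0) else 0)
      = s.busy i' j' := by
    intro i'
    by_cases hi : i' = i
    · subst hi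
      by_cases hj : j' = j
      · subst hj; simp [State.complete]; omega
      · simp [State.complete, hj]
    · simp [State.complete, hi]
  simp only [State.total, ← this, Finset.sum_add_distrib, Finset.sum_ite_eq', Finset.mem_univ,
    if_true]

variable [Fintype J]

open Classical in
/-- Effect of an arrival on the exponential functional. -/
lemma expFunctional_afterArrival {E : I → J → Prop} {β : J → ℝ} (hβ : ∀ j, 0 < β j)
    {N : J → ℕ} {P : Policy E β N} {r : ℝ} {s : State I J}
    (A : ActionLevels P r s) {B : ℝ} (hB : ∀ j, 1 / β j ≤ B) {κ η θ : ℝ} (hκ : 0 ≤ κ)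
    (hη : ∀ y : ℝ, |y| ≤ η → Real.exp y ≤ 1 + y + κ * y ^ 2) (hθ : |θ| * (1 / √r) ≤ η)
    (hθB : |θ| * (B * (1 / √r)) ≤ η) (i : I) (t : State I J)
    (ht : t ∈ (afterArrival P s i).support) :
    expFunctional β r θ t ≤ expFunctional β r θ s +
      Real.exp (θ * A.y i) * (θ * (1 / √r) +
        κ * θ ^ 2 * (1 / √r) ^ 2 * if SeesIdle E N s i then B else 1) := by
  have hr0 : 0 ≤ 1 / √r := by positivity
  by_cases h : SeesIdle E N s i
  · rw [afterArrival, if_pos h, PMF.mem_support_map_iff] at ht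
    obtain ⟨j, hj, rfl⟩ := ht
    have hβj := hβ j
    have hk : scaledLoad β r (s.start i j) j = scaledLoad β r s j + 1 / β j * (1 / √r) := by
      simp only [scaledLoad, scaledIdle, State.total_start, if_true]
      push_cast
      ring
    rw [expFunctional_of_total hk (fun j' hj' => by simp [State.total_start, hj']) fun _ => rfl,
      (A.y_of_idle i h).2 j hj, if_pos h]
    have hd : |θ * (1 / β j * (1 / √r))| ≤ η := by
      rw [abs_mul, abs_of_nonneg (by positivity : 0 ≤ 1 / β j * (1 / √r))]
      refine le_trans ?_ hθB
      gcongr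
      exact hB j
    refine add_le_add_right ((exp_increment_le hη hd hβj.le).trans ?_) _
    -- The weight `β j` cancels the step size `1 / β j` to first order; to second order a factor `1
    -- / β j ≤ B` remains.
    have e1 : β j * (1 / β j * (1 / √r)) = 1 / √r := by field_simp
    have e2 : β j * (1 / β j * (1 / √r)) ^ 2 = (1 / √r) ^ 2 * (1 / β j) := by field_simp
    rw [e1, e2, ← mul_assoc (κ * θ ^ 2)]
    gcongr
    exact hB j
  · rw [afterArrival, if_neg h, PMF.mem_support_pure_iff] at ht
    subst ht
    have hk : scaledQueue r (s.enqueue i) i = scaledQueue r s i + 1 / √r := by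
      simp only [scaledQueue, State.enqueue, Function.update_self]
      push_cast
      ring
    rw [expFunctional_of_queue hk (fun i' hi' => by simp [State.enqueue, hi']) fun _ => rfl,
      A.y_of_not_idle i h, if_neg h]
    have hd : |θ * (1 / √r)| ≤ η := by rwa [abs_mul, abs_of_nonneg hr0]
    refine add_le_add_right ?_ _
    have := exp_increment_le (q := scaledQueue r s i) hη hd one_pos.le
    simpa [mul_assoc] using this

open Classical in
/-- Effect of a service completion on the exponential functional. -/
lemma expFunctional_afterService {E : I → J → Prop} {β : J → ℝ} (hβ : ∀ j, 0 < β j)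
    {N : J → ℕ} {P : Policy E β N} {r : ℝ} {s : State I J}
    (A : ActionLevels P r s) {B : ℝ} (hB : ∀ j, 1 / β j ≤ B) {κ η θ : ℝ} (hκ : 0 ≤ κ)
    (hη : ∀ y : ℝ, |y| ≤ η → Real.exp y ≤ 1 + y + κ * y ^ 2) (hθ : |θ| * (1 / √r) ≤ η)
    (hθB : |θ| * (B * (1 / √r)) ≤ η) (i : I) (j : J) (hij : 0 < s.busy i j) (t : State I J)
    (ht : t ∈ (afterService P s i j).support) :
    expFunctional β r θ t ≤ expFunctional β r θ s +
      Real.exp (θ * A.w j) * (- (θ * (1 / √r)) +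
        κ * θ ^ 2 * (1 / √r) ^ 2 * if SeesWaiting E s j then 1 else B) := by
  have hr0 : 0 ≤ 1 / √r := by positivity
  by_cases h : SeesWaiting E s j
  · rw [afterService, if_pos h, PMF.mem_support_map_iff] at ht
    obtain ⟨k, hk, rfl⟩ := ht
    obtain ⟨hq, hw⟩ := A.w_of_waiting j h i k hk
    have hkq : scaledQueue r (((s.complete i j).dequeue k).start k j) k
        = scaledQueue r s k + -(1 / √r) := by
      simp only [scaledQueue, State.start, State.dequeue, State.complete, Function.update_self]
      rw [Nat.cast_sub hq]
      push_cast
      ring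
    have htot : ∀ j', (((s.complete i j).dequeue k).start k j).total j' = s.total j' := fun j' => by
      rw [State.total_start, ← s.total_complete hij]
      rfl
    rw [expFunctional_of_queue hkq
      (fun i' hi' => by simp [State.start, State.dequeue, State.complete, hi']) htot, hw, if_pos h]
    have hd : |θ * -(1 / √r)| ≤ η := by rwa [abs_mul, abs_neg, abs_of_nonneg hr0]
    refine add_le_add_right ?_ _
    have := exp_increment_le (q := A.w j) hη hd one_pos.le
    simpa [mul_assoc] using this
  · rw [afterService, if_neg h, PMF.mem_support_pure_iff] at ht
    subst ht
    have hβj := hβ j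
    have htj := s.total_complete hij j
    rw [if_pos rfl] at htj
    have hk : scaledLoad β r (s.complete i j) j
        = scaledLoad β r s j + -(1 / β j * (1 / √r)) := by
      simp only [scaledLoad, scaledIdle, ← htj]
      push_cast
      ring
    rw [expFunctional_of_total hk
      (fun j' hj' => by simpa [hj'] using s.total_complete hij j') fun _ => rfl,
      A.w_of_not_waiting j h, if_neg h]
    have hd : |θ * -(1 / β j * (1 / √r))| ≤ η := by
      rw [abs_mul, abs_neg, abs_of_nonneg (by positivity : 0 ≤ 1 / β j * (1 / √r))]
      refine le_trans ?_ hθB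
      gcongr
      exact hB j
    refine add_le_add_right ((exp_increment_le hη hd hβj.le).trans ?_) _
    have e1 : θ * (β j * -(1 / β j * (1 / √r))) = -(θ * (1 / √r)) := by field_simp
    have e2 : β j * (-(1 / β j * (1 / √r))) ^ 2 = (1 / √r) ^ 2 * (1 / β j) := by field_simp
    rw [e1, e2, ← mul_assoc (κ * θ ^ 2)]
    gcongr
    exact hB j

end Transitions

/-! ### Drift estimates -/

/-- Flows `x` that load every pool critically when the service rates are `m`. -/
structure CriticalFlow {I J : Type*} [Fintype I] [Fintype J] (lam : I → ℝ) (β m : J → ℝ)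
    (x : I → J → ℝ) : Prop where
  lam_pos : ∀ i, 0 < lam i
  β_pos : ∀ j, 0 < β j
  m_pos : ∀ j, 0 < m j
  nonneg : ∀ i j, 0 ≤ x i j
  sum_pool : ∀ i, ∑ j, x i j = lam i
  sum_class : ∀ j, ∑ i, x i j = β j * m j
  connected : (activityGraph (Basic x)).Connected

section Drift

variable {I J : Type*} [Fintype I] [Fintype J] {lam : I → ℝ} {β m : J → ℝ} {x : I → J → ℝ}

lemma CriticalFlow.sum_capacity (hx : CriticalFlow lam β m x) :
    ∑ j, β j * m j = ∑ i, lam i := by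
  simp_rw [← hx.sum_class, ← hx.sum_pool]
  exact Finset.sum_comm

/-- The drift of the exponential functional, up to third order terms, in terms of the prices `u` of
arrivals and `v` of service completions. -/
noncomputable def priceDrift (lam l : I → ℝ) (β m : J → ℝ) (x : I → J → ℝ) (θ κ r : ℝ)
    (u : I → ℝ) (v z : J → ℝ) (c : I → ℝ) (c' : J → ℝ) : ℝ :=
  θ * (∑ i, l i * u i - ∑ j, β j * m j * (z j * v j) - √r * ∑ i, ∑ j, x i j * (v j - u i)) +
    κ * θ ^ 2 * (∑ i, (lam i + l i * (1 / √r)) * (c i * u i) +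
      ∑ j, β j * m j * ((1 + z j * (1 / √r)) * (c' j * v j)))

/-- An exact identity: pool `j` has `β j * (r + √r * z j)` busy servers, and the terms of order `√r`
combine because `x` has marginals `lam i` and `β j * m j`. -/
lemma CriticalFlow.sum_eq_priceDrift (hx : CriticalFlow lam β m x) {μ : I → J → ℝ}
    (hm : ∀ i j, Basic x i j → μ i j = m j) {N : J → ℕ} {r : ℝ} (hr : 0 < r)
    {s : State I J} (hs : Admissible (Basic x) N s) (l : I → ℝ) (θ κ : ℝ) (u : I → ℝ) (v : J → ℝ)
    (c : I → ℝ) (c' : J → ℝ) :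
    ∑ i, (r * lam i + √r * l i) * (u i * (θ * (1 / √r) + κ * θ ^ 2 * (1 / √r) ^ 2 * c i)) +
      ∑ i, ∑ j, μ i j * s.busy i j *
        (v j * (-(θ * (1 / √r)) + κ * θ ^ 2 * (1 / √r) ^ 2 * c' j)) =
    priceDrift lam l β m x θ κ r u v (scaledLoad β r s) c c' := by
  have hR : 0 < √r := Real.sqrt_pos.2 hr
  have hrr : r = √r * √r := (Real.mul_self_sqrt hr.le).symm
  have hbusy : ∀ i j, μ i j * s.busy i j = m j * s.busy i j := fun i j => by
    by_cases h : Basic x i j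
    · rw [hm i j h]
    · simp [hs.1 i j h]
  have htot : ∀ j, (s.total j : ℝ) = β j * (√r * √r + √r * scaledLoad β r s j) := fun j => by
    have := hx.β_pos j
    rw [scaledLoad, scaledIdle, ← hrr]
    field_simp
    ring
  have e1 : ∑ i, (r * lam i + √r * l i) * (u i * (θ * (1 / √r) + κ * θ ^ 2 * (1 / √r) ^ 2 * c i))
      = θ * (√r * ∑ i, lam i * u i + ∑ i, l i * u i) +
        κ * θ ^ 2 * ∑ i, (lam i + l i * (1 / √r)) * (c i * u i) := by
    simp_rw [Finset.mul_sum, ← Finset.sum_add_distrib, Finset.mul_sum, ← Finset.sum_add_distrib]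
    refine Finset.sum_congr rfl fun i _ => ?_
    generalize √r = R at *
    subst hrr
    field_simp
  have e2 : ∑ i, ∑ j, μ i j * s.busy i j *
        (v j * (-(θ * (1 / √r)) + κ * θ ^ 2 * (1 / √r) ^ 2 * c' j))
      = - (θ * (√r * ∑ j, β j * m j * v j + ∑ j, β j * m j * (scaledLoad β r s j * v j))) +
        κ * θ ^ 2 * ∑ j, β j * m j * ((1 + scaledLoad β r s j * (1 / √r)) * (c' j * v j)) := by
    rw [Finset.sum_comm]
    simp_rw [hbusy]
    have : ∀ j, ∑ i, m j * s.busy i j *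
        (v j * (-(θ * (1 / √r)) + κ * θ ^ 2 * (1 / √r) ^ 2 * c' j))
        = m j * s.total j * (v j * (-(θ * (1 / √r)) + κ * θ ^ 2 * (1 / √r) ^ 2 * c' j)) := by
      intro j
      rw [← Finset.sum_mul, ← Finset.mul_sum, State.total, Nat.cast_sum]
    simp_rw [this, htot, Finset.mul_sum, ← Finset.sum_add_distrib, Finset.mul_sum,
      ← Finset.sum_neg_distrib, ← Finset.sum_add_distrib]
    refine Finset.sum_congr rfl fun j _ => ?_
    field_simp
  have e3 : ∑ i, ∑ j, x i j * (v j - u i) = ∑ j, β j * m j * v j - ∑ i, lam i * u i := by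
    simp_rw [mul_sub, Finset.sum_sub_distrib]
    congr 1
    · rw [Finset.sum_comm]
      simp_rw [← Finset.sum_mul, hx.sum_class]
    · simp_rw [← Finset.sum_mul, hx.sum_pool]
  rw [e1, e2, priceDrift, e3]
  ring

/-- For a positive exponent, the loss of service through idleness costs only a bounded amount. -/
lemma neg_mul_exp_le {θ : ℝ} (hθ : 0 < θ) (z : ℝ) : -(z * Real.exp (θ * z)) ≤ 1 / θ := by
  have h := Real.add_one_le_exp (-(θ * z))
  have he := Real.exp_pos (θ * z)
  have h1 : Real.exp (-(θ * z)) * Real.exp (θ * z) = 1 := by rw [← Real.exp_add]; simp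
  rw [le_div_iff₀ hθ]
  nlinarith

/-- Drift for positive exponents: the largest price decreases at a linear rate. -/
lemma CriticalFlow.priceDrift_le_of_pos (hx : CriticalFlow lam β m x) [Nonempty I] [Nonempty J]
    {l : I → ℝ} {C : ℝ} (hl : ∑ i, l i = -(C * ∑ i, lam i)) {θ : ℝ} (hθ : 0 < θ) {κ : ℝ}
    (hκ : 0 ≤ κ) {K : ℝ} (hK : ∀ (u : I → ℝ) (v : J → ℝ), (∀ i j, Basic x i j → u i ≤ v j) →
      ∀ a b : I ⊕ J, |Sum.elim u v a - Sum.elim u v b| ≤ K * ∑ i, ∑ j, x i j * (v j - u i))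
    {r : ℝ} (hr : (∑ i, |l i|) * K ≤ √r)
    (hκr : κ * θ * (2 * (∑ i, lam i) + (∑ i, |l i|) * (1 / √r)) ≤ (∑ i, lam i) * ((C + θ) / 2))
    {u : I → ℝ} {v z : J → ℝ} (hu : ∀ i, 0 ≤ u i) (hv : ∀ j, 0 ≤ v j)
    (huv : ∀ i j, Basic x i j → u i ≤ v j) (hz : ∀ j, z j ≤ 0)
    (hzv : ∀ j, z j * v j = z j * Real.exp (θ * z j))
    {B : ℝ} (hB : 0 ≤ B) {c : I → ℝ} {c' : J → ℝ} (hc : ∀ i, 0 ≤ c i) (hc' : ∀ j, 0 ≤ c' j)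
    (hcu : ∀ i, c i * u i ≤ u i + B) (hcv : ∀ j, c' j * v j ≤ v j + B) {M : ℝ}
    (hM : ∀ j, v j ≤ M) (hM' : ∃ j, M = v j) :
    priceDrift lam l β m x θ κ r u v z c c' ≤
      (∑ i, lam i) * (1 + θ * ((C + θ) / 2) * B) - (∑ i, lam i) * θ * ((C - θ) / 2) * M := by
  set L := ∑ i, |l i| with hL
  set Λ := ∑ i, lam i with hΛ
  set D := ∑ i, ∑ j, x i j * (v j - u i) with hD
  have hD0 : 0 ≤ D := by
    refine Finset.sum_nonneg fun i _ => Finset.sum_nonneg fun j _ => ?_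
    rcases (hx.nonneg i j).lt_or_eq with hp | h0
    · exact mul_nonneg hp.le (sub_nonneg.2 (huv i j hp))
    · simp [← h0]
  have hM0 : 0 ≤ M := by obtain ⟨j, rfl⟩ := hM'; exact hv j
  have huM : ∀ i, u i ≤ M := fun i => by
    obtain ⟨j, hj⟩ := exists_edge_of_class hx.connected i
    exact (huv i j hj).trans (hM j)
  -- All prices are within `K * D` of the largest one, so only the total of `l` matters, up to a
  -- multiple of `D`.
  have h1 : ∑ i, l i * u i ≤ -(C * Λ) * M + L * (K * D) := by
    rw [← hl, Finset.sum_mul, hL, Finset.sum_mul, ← Finset.sum_add_distrib]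
    refine Finset.sum_le_sum fun i _ => ?_
    obtain ⟨j, rfl⟩ := hM'
    have h := hK u v huv (Sum.inl i) (Sum.inr j)
    simp only [Sum.elim_inl, Sum.elim_inr] at h
    have h2 : l i * (u i - v j) ≤ |l i| * (K * D) := by
      refine (le_abs_self _).trans ?_
      rw [abs_mul]
      exact mul_le_mul_of_nonneg_left h (abs_nonneg _)
    linarith
  have h2 : -∑ j, β j * m j * (z j * v j) ≤ Λ * (1 / θ) := by
    rw [hΛ, ← hx.sum_capacity, ← Finset.sum_neg_distrib, Finset.sum_mul]
    refine Finset.sum_le_sum fun j _ => ?_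
    rw [hzv, ← mul_neg]
    exact mul_le_mul_of_nonneg_left (neg_mul_exp_le hθ _)
      (mul_nonneg (hx.β_pos j).le (hx.m_pos j).le)
  have h3 : ∑ i, (lam i + l i * (1 / √r)) * (c i * u i) ≤ (Λ + L * (1 / √r)) * (M + B) := by
    rw [hΛ, hL, Finset.sum_mul, ← Finset.sum_add_distrib, Finset.sum_mul]
    refine Finset.sum_le_sum fun i _ => ?_
    have hr0 : 0 ≤ 1 / √r := by positivity
    refine mul_le_mul ?_ ((hcu i).trans (by linarith [huM i])) (mul_nonneg (hc i) (hu i)) ?_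
    · gcongr
      exact le_abs_self _
    · exact add_nonneg (hx.lam_pos i).le (mul_nonneg (abs_nonneg _) hr0)
  have h4 : ∑ j, β j * m j * ((1 + z j * (1 / √r)) * (c' j * v j)) ≤ Λ * (M + B) := by
    rw [hΛ, ← hx.sum_capacity, Finset.sum_mul]
    refine Finset.sum_le_sum fun j _ => ?_
    refine mul_le_mul_of_nonneg_left ?_ (mul_nonneg (hx.β_pos j).le (hx.m_pos j).le)
    have hr0 : 0 ≤ 1 / √r := by positivity
    have hz2 : 1 + z j * (1 / √r) ≤ 1 := by
      have := mul_nonneg (neg_nonneg.2 (hz j)) hr0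
      linarith
    calc (1 + z j * (1 / √r)) * (c' j * v j) ≤ 1 * (c' j * v j) :=
          mul_le_mul_of_nonneg_right hz2 (mul_nonneg (hc' j) (hv j))
      _ ≤ M + B := by linarith [hcv j, hM j]
  have h5 : L * (K * D) ≤ √r * D := by
    rw [← mul_assoc]; exact mul_le_mul_of_nonneg_right hr hD0
  have h6 : θ * (∑ i, l i * u i - ∑ j, β j * m j * (z j * v j) - √r * D)
      ≤ θ * (-(C * Λ) * M + Λ * (1 / θ)) :=
    mul_le_mul_of_nonneg_left (by linarith) hθ.le
  have h7 : κ * θ ^ 2 * (∑ i, (lam i + l i * (1 / √r)) * (c i * u i) +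
      ∑ j, β j * m j * ((1 + z j * (1 / √r)) * (c' j * v j)))
      ≤ θ * (κ * θ * (2 * Λ + L * (1 / √r))) * (M + B) := by
    have : κ * θ ^ 2 * (∑ i, (lam i + l i * (1 / √r)) * (c i * u i) +
        ∑ j, β j * m j * ((1 + z j * (1 / √r)) * (c' j * v j)))
        ≤ κ * θ ^ 2 * ((Λ + L * (1 / √r)) * (M + B) + Λ * (M + B)) :=
      mul_le_mul_of_nonneg_left (by linarith) (by positivity)
    refine this.trans (le_of_eq ?_)
    ring
  have h8 : θ * (κ * θ * (2 * Λ + L * (1 / √r))) * (M + B)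
      ≤ θ * (Λ * ((C + θ) / 2)) * (M + B) :=
    mul_le_mul_of_nonneg_right (mul_le_mul_of_nonneg_left hκr hθ.le) (by linarith)
  have h9 : θ * (-(C * Λ) * M + Λ * (1 / θ)) = -(θ * C * Λ * M) + Λ := by
    field_simp
  rw [priceDrift, ← hD]
  refine (add_le_add h6 (h7.trans h8)).trans (le_of_eq ?_)
  rw [h9]
  ring

/-- Idleness beyond `T` yields a restoring rate of at least `T`; below `T` the exponential is
bounded. -/
lemma mul_exp_le_of_neg {θ : ℝ} (hθ : θ < 0) {z : ℝ} (hz : z ≤ 0) {T : ℝ} (hT : 0 ≤ T) :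
    z * Real.exp (θ * z) ≤ T * Real.exp (-(θ * T)) - T * Real.exp (θ * z) := by
  rcases le_or_gt z (-T) with h | h
  · have h1 := mul_nonneg (neg_nonneg.2 (by linarith : z + T ≤ 0)) (Real.exp_pos (θ * z)).le
    have h2 := mul_nonneg hT (Real.exp_pos (-(θ * T))).le
    linarith
  · have h1 : Real.exp (θ * z) ≤ Real.exp (-(θ * T)) := Real.exp_le_exp.2 (by nlinarith)
    have h2 : (z + T) * Real.exp (θ * z) ≤ T * Real.exp (-(θ * T)) :=
      mul_le_mul (by linarith) h1 (Real.exp_pos _).le hT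
    linarith

/-- Drift for negative exponents. -/
lemma CriticalFlow.priceDrift_le_of_neg (hx : CriticalFlow lam β m x)
    {l : I → ℝ} {θ : ℝ} (hθ : θ < 0) {r : ℝ} (hr : 1 ≤ √r)
    {u : I → ℝ} {v z : J → ℝ} (hu : ∀ i, 0 ≤ u i) (hv : ∀ j, 0 ≤ v j)
    (huv : ∀ i j, Basic x i j → v j ≤ u i) (hz : ∀ j, z j ≤ 0)
    (hzv : ∀ j, z j * v j = z j * Real.exp (θ * z j))
    {B : ℝ} (hB : 0 ≤ B) {c : I → ℝ} {c' : J → ℝ} (hc : ∀ i, 0 ≤ c i) (hc' : ∀ j, 0 ≤ c' j)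
    (hcB : ∀ i, c i ≤ B) (hcB' : ∀ j, c' j ≤ B)
    (huH : ∀ i, u i ≤ ∑ j, Real.exp (θ * z j)) (hvH : ∀ j, v j ≤ ∑ j, Real.exp (θ * z j))
    {ε T : ℝ} (hε : ∀ j, ε ≤ β j * m j) (hT : 0 ≤ T) :
    priceDrift lam l β m x θ 1 r u v z c c' ≤ -θ * (T * Real.exp (-(θ * T)) * ∑ i, lam i) -
      (-θ * (T * ε) + θ * ∑ i, |l i| - θ ^ 2 * ((2 * ∑ i, lam i + ∑ i, |l i|) * B)) *
        ∑ j, Real.exp (θ * z j) := by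
  set L := ∑ i, |l i| with hL
  set Λ := ∑ i, lam i with hΛ
  set H := ∑ j, Real.exp (θ * z j) with hH
  have hH0 : 0 ≤ H := Finset.sum_nonneg fun j _ => (Real.exp_pos _).le
  have hr0 : 0 ≤ 1 / √r := by positivity
  have hr1 : 1 / √r ≤ 1 := by rw [div_le_one (by linarith)]; exact hr
  have hD0 : ∑ i, ∑ j, x i j * (v j - u i) ≤ 0 := by
    refine Finset.sum_nonpos fun i _ => Finset.sum_nonpos fun j _ => ?_
    rcases (hx.nonneg i j).lt_or_eq with hp | h0
    · exact mul_nonpos_of_nonneg_of_nonpos hp.le (sub_nonpos.2 (huv i j hp))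
    · simp [← h0]
  have h1 : -∑ i, l i * u i ≤ L * H := by
    rw [hL, Finset.sum_mul, ← Finset.sum_neg_distrib]
    refine Finset.sum_le_sum fun i _ => ?_
    rw [← neg_mul]
    exact mul_le_mul (neg_le_abs _) (huH i) (hu i) (abs_nonneg _)
  have h2 : ∑ j, β j * m j * (z j * v j) ≤ T * Real.exp (-(θ * T)) * Λ - T * ε * H := by
    rw [hΛ, ← hx.sum_capacity, hH, Finset.mul_sum, Finset.mul_sum, ← Finset.sum_sub_distrib]
    refine Finset.sum_le_sum fun j _ => ?_
    have hb := mul_nonneg (hx.β_pos j).le (hx.m_pos j).le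
    rw [hzv]
    have e1 := mul_le_mul_of_nonneg_left (mul_exp_le_of_neg hθ (hz j) hT) hb
    have e2 := mul_le_mul_of_nonneg_right (hε j) (mul_nonneg hT (Real.exp_pos (θ * z j)).le)
    linarith
  have h3 : ∑ i, (lam i + l i * (1 / √r)) * (c i * u i) ≤ (Λ + L) * (B * H) := by
    rw [hΛ, hL, ← Finset.sum_add_distrib, Finset.sum_mul]
    refine Finset.sum_le_sum fun i _ => ?_
    refine mul_le_mul ?_ (mul_le_mul (hcB i) (huH i) (hu i) hB) (mul_nonneg (hc i) (hu i))
      (add_nonneg (hx.lam_pos i).le (abs_nonneg _))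
    gcongr
    calc l i * (1 / √r) ≤ |l i| * (1 / √r) := mul_le_mul_of_nonneg_right (le_abs_self _) hr0
      _ ≤ |l i| := mul_le_of_le_one_right (abs_nonneg _) hr1
  have h4 : ∑ j, β j * m j * ((1 + z j * (1 / √r)) * (c' j * v j)) ≤ Λ * (B * H) := by
    rw [hΛ, ← hx.sum_capacity, Finset.sum_mul]
    refine Finset.sum_le_sum fun j _ => ?_
    refine mul_le_mul_of_nonneg_left ?_ (mul_nonneg (hx.β_pos j).le (hx.m_pos j).le)
    have hz2 : 1 + z j * (1 / √r) ≤ 1 := by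
      have := mul_nonneg (neg_nonneg.2 (hz j)) hr0
      linarith
    calc (1 + z j * (1 / √r)) * (c' j * v j) ≤ 1 * (c' j * v j) :=
          mul_le_mul_of_nonneg_right hz2 (mul_nonneg (hc' j) (hv j))
      _ ≤ B * H := by rw [one_mul]; exact mul_le_mul (hcB' j) (hvH j) (hv j) hB
  have h5 : √r * ∑ i, ∑ j, x i j * (v j - u i) ≤ 0 :=
    mul_nonpos_of_nonneg_of_nonpos (Real.sqrt_nonneg _) hD0
  have h6 : θ * (∑ i, l i * u i - ∑ j, β j * m j * (z j * v j) -
      √r * ∑ i, ∑ j, x i j * (v j - u i))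
      ≤ -θ * (L * H + (T * Real.exp (-(θ * T)) * Λ - T * ε * H)) := by
    rw [← neg_mul_neg]
    exact mul_le_mul_of_nonneg_left (by linarith) (by linarith)
  have h7 := mul_le_mul_of_nonneg_left (add_le_add h3 h4)
    (show 0 ≤ 1 * θ ^ 2 by positivity)
  rw [priceDrift]
  refine (add_le_add h6 h7).trans (le_of_eq ?_)
  ring

end Drift

/-! ### Moment bounds -/

lemma expFunctional_nonneg {I J : Type*} [Fintype I] [Fintype J] {β : J → ℝ} (hβ : ∀ j, 0 < β j) (r θ : ℝ) (s : State I J) :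
    0 ≤ expFunctional β r θ s :=
  add_nonneg (Finset.sum_nonneg fun _ _ => (Real.exp_pos _).le)
    (Finset.sum_nonneg fun j _ => mul_nonneg (hβ j).le (Real.exp_pos _).le)

lemma exists_inv_bound {J : Type*} [Fintype J] {β : J → ℝ} (hβ : ∀ j, 0 < β j) : ∃ B, 1 ≤ B ∧ ∀ j, 1 / β j ≤ B := by
  have h0 : ∀ j, 0 ≤ 1 / β j := fun j => (one_div_pos.2 (hβ j)).le
  refine ⟨1 + ∑ j, 1 / β j, by linarith [Finset.sum_nonneg fun j (_ : j ∈ Finset.univ) => h0 j],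
    fun j => ?_⟩
  linarith [Finset.single_le_sum (fun j _ => h0 j) (Finset.mem_univ j)]

section Levels

variable {I J : Type*} [Fintype I] {β : J → ℝ} {x : I → J → ℝ}
  {N : J → ℕ} {P : Policy (Basic x) β N} {r : ℝ} {s : State I J}

/-- The two levels differ only when a compatible customer waits; then the pool is full and its load
is 0. -/
lemma ActionLevels.scaledLoad_mul_exp (hβ : ∀ j, 0 < β j) (hr : 0 < r)
    (hN : ∀ j, (N j : ℝ) = r * β j) (hs : Admissible (Basic x) N s) (A : ActionLevels P r s)
    (θ : ℝ) (j : J) : scaledLoad β r s j * Real.exp (θ * A.w j)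
      = scaledLoad β r s j * Real.exp (θ * scaledLoad β r s j) := by
  by_cases h : SeesWaiting (Basic x) s j
  · obtain ⟨i, hij, hq⟩ := h
    rw [(total_eq_of_scaledLoad_eq_zero hβ hr hN).2 (hs.2.2 i j hij hq), zero_mul, zero_mul]
  · rw [A.w_of_not_waiting j h]

lemma Admissible.exp_scaledLoad_le_one (hs : Admissible (Basic x) N s) (hβ : ∀ j, 0 < β j)
    (hN : ∀ j, (N j : ℝ) = r * β j) {θ : ℝ} (hθ : 0 ≤ θ) (j : J) :
    Real.exp (θ * scaledLoad β r s j) ≤ 1 :=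
  Real.exp_le_one_iff.2 (mul_nonpos_of_nonneg_of_nonpos hθ (hs.scaledLoad_nonpos hβ hN j))

end Levels

section Moments

variable {I J : Type*} [Fintype I] [Fintype J] [DecidableEq I] [DecidableEq J]
  {lam : I → ℝ} {β m : J → ℝ} {x : I → J → ℝ}

open Classical in
-- For large `r` the jumps are small enough for the quadratic bound on the exponential and the
-- arrival rates are nonnegative, so a pointwise bound on `priceDrift` is enough.
lemma CriticalFlow.eventually_expect_le (hx : CriticalFlow lam β m x) {μ : I → J → ℝ}
    (hμ : ∀ i j, 0 ≤ μ i j) (hm : ∀ i j, Basic x i j → μ i j = m j) {l : I → ℝ}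
    {r : ℕ → ℝ} (hr_lim : Filter.Tendsto r Filter.atTop Filter.atTop)
    {N : ℕ → J → ℕ} (hN : ∀ n j, (N n j : ℝ) = r n * β j)
    {P : (n : ℕ) → Policy (Basic x) β (N n)} {p : ℕ → PMF (State I J)}
    (hp : ∀ᶠ n in Filter.atTop,
      IsStationary (P n) (fun i => r n * lam i + √(r n) * l i) μ (p n))
    {θ κ B b c : ℝ} (hκ : 1 / 2 < κ) (hB : ∀ j, 1 / β j ≤ B) (hb : 0 ≤ b) (hc : 0 < c)
    (hdrift : ∀ᶠ R in Filter.atTop, ∀ (N : J → ℕ) (P : Policy (Basic x) β N) (s : State I J),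
      (∀ j, (N j : ℝ) = R * β j) → Admissible (Basic x) N s → ∀ A : ActionLevels P R s,
      priceDrift lam l β m x θ κ R (fun i => Real.exp (θ * A.y i)) (fun j => Real.exp (θ * A.w j))
        (scaledLoad β R s) (fun i => if SeesIdle (Basic x) N s i then B else 1)
        (fun j => if SeesWaiting (Basic x) s j then 1 else B) ≤ b - c * expFunctional β R θ s) :
    ∀ᶠ n in Filter.atTop,
      expect (p n) (expFunctional β (r n) θ) ≤ ENNReal.ofReal (b / c) := by
  obtain ⟨η, hη0, hη⟩ := exists_exp_le_quadratic hκ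
  have hsqrt : Filter.Tendsto (fun n => √(r n)) Filter.atTop Filter.atTop :=
    Real.tendsto_sqrt_atTop.comp hr_lim
  have hinv : ∀ a : ℝ, ∀ᶠ n in Filter.atTop, a * (1 / √(r n)) ≤ η := fun a => by
    have h0 : Filter.Tendsto (fun n => a * (1 / √(r n))) Filter.atTop (nhds 0) := by
      simpa using (tendsto_inv_atTop_zero.comp hsqrt).const_mul a
    exact (h0.eventually (gt_mem_nhds hη0)).mono fun n hn => hn.le
  have hrate : ∀ᶠ n in Filter.atTop, ∀ i, 0 ≤ r n * lam i + √(r n) * l i := by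
    refine Filter.eventually_all.2 fun i => ?_
    filter_upwards [hsqrt.eventually_ge_atTop (-l i / lam i), hr_lim.eventually_ge_atTop 0]
      with n hn hn0
    rw [div_le_iff₀ (hx.lam_pos i)] at hn
    have e : r n * lam i + √(r n) * l i = √(r n) * (√(r n) * lam i + l i) := by
      rw [mul_add, ← mul_assoc, Real.mul_self_sqrt hn0]
    rw [e]
    exact mul_nonneg (Real.sqrt_nonneg _) (by linarith)
  filter_upwards [hp, hinv |θ|, hinv (|θ| * B), hrate, hr_lim.eventually hdrift,
    hr_lim.eventually_gt_atTop 0] with n hpn h1 h2 h3 h4 h5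
  refine hpn.expect_le h3 hμ _ (expFunctional_nonneg hx.β_pos _ _) hc hb fun s hs => ?_
  obtain ⟨A⟩ := exists_actionLevels hx.β_pos (P n) h5 (hN n) hs
  have h2' : |θ| * (B * (1 / √(r n))) ≤ η := by rwa [← mul_assoc]
  refine ⟨_, fun i j => _,
    fun i t ht => expFunctional_afterArrival hx.β_pos A hB (by linarith) hη h1 h2' i t ht,
    fun i j hij t ht =>
      expFunctional_afterService hx.β_pos A hB (by linarith) hη h1 h2' i j hij t ht, ?_⟩
  rw [hx.sum_eq_priceDrift hm h5 hs]
  exact h4 (N n) (P n) s (hN n) hs A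

variable [Nonempty I] [Nonempty J]

/-- Exponential moments with a positive exponent `θ < C`. -/
lemma CriticalFlow.exists_expect_le_of_pos (hx : CriticalFlow lam β m x) {μ : I → J → ℝ}
    (hμ : ∀ i j, 0 ≤ μ i j) (hm : ∀ i j, Basic x i j → μ i j = m j) {l : I → ℝ} {C : ℝ}
    (hl : ∑ i, l i = -(C * ∑ i, lam i))
    {r : ℕ → ℝ} (hr_lim : Filter.Tendsto r Filter.atTop Filter.atTop)
    {N : ℕ → J → ℕ} (hN : ∀ n j, (N n j : ℝ) = r n * β j)
    {P : (n : ℕ) → Policy (Basic x) β (N n)} {p : ℕ → PMF (State I J)}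
    (hp : ∀ᶠ n in Filter.atTop,
      IsStationary (P n) (fun i => r n * lam i + √(r n) * l i) μ (p n))
    {θ : ℝ} (hθ : 0 < θ) (hθC : θ < C) :
    ∃ K : ℝ, ∀ᶠ n in Filter.atTop,
      expect (p n) (expFunctional β (r n) θ) ≤ ENNReal.ofReal K := by
  classical
  obtain ⟨B, hB1, hB⟩ := exists_inv_bound hx.β_pos
  obtain ⟨K, hK0, hK⟩ := exists_oscillation_bound hx.nonneg hx.connected
  set Λ := ∑ i, lam i with hΛ
  have hΛ0 : 0 < Λ := Finset.sum_pos (fun i _ => hx.lam_pos i) Finset.univ_nonempty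
  -- `κ * θ` is the midpoint of `θ / 2` and `(C + θ) / 4`: above the first for the quadratic bound,
  -- below the second to leave room for the vanishing `1 / √r` term.
  set κ := 1 / 4 + (C + θ) / (8 * θ) with hκ
  have hκθ : κ * θ = θ / 4 + (C + θ) / 8 := by rw [hκ]; field_simp
  have hκ2 : 1 / 2 < κ := by
    by_contra! h
    have := mul_le_mul_of_nonneg_right h hθ.le
    rw [hκθ] at this
    linarith
  set n : ℝ := (Fintype.card I : ℝ) with hn
  have hn0 : 0 < n := by rw [hn]; exact_mod_cast Fintype.card_pos
  have hS : 0 ≤ ∑ j, β j := Finset.sum_nonneg fun j _ => (hx.β_pos j).le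
  have hc0 : 0 < Λ * θ * ((C - θ) / 2) := mul_pos (mul_pos hΛ0 hθ) (by linarith)
  refine ⟨_, hx.eventually_expect_le (b := Λ * (1 + θ * ((C + θ) / 2) * B) +
    Λ * θ * ((C - θ) / 2) / n * (n + ∑ j, β j)) (c := Λ * θ * ((C - θ) / 2) / n) hμ hm hr_lim hN hp
    hκ2 hB ?_ (div_pos hc0 hn0) ?_⟩
  · have : 0 < C + θ := by linarith
    positivity
  have hsmall : ∀ᶠ R in Filter.atTop,
      κ * θ * (2 * Λ + (∑ i, |l i|) * (1 / √R)) ≤ Λ * ((C + θ) / 2) := by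
    have h0 : Filter.Tendsto (fun R : ℝ => κ * θ * (2 * Λ + (∑ i, |l i|) * (1 / √R)))
        Filter.atTop (nhds (κ * θ * (2 * Λ + (∑ i, |l i|) * 0))) := by
      simp_rw [one_div]
      exact (((tendsto_inv_atTop_zero.comp Real.tendsto_sqrt_atTop).const_mul _).const_add
        _).const_mul _
    refine (h0.eventually (gt_mem_nhds ?_)).mono fun R hR => hR.le
    rw [hκθ, mul_zero, add_zero]
    nlinarith
  filter_upwards [hsmall, Real.tendsto_sqrt_atTop.eventually_ge_atTop ((∑ i, |l i|) * K),
    Filter.eventually_gt_atTop 0] with R h1 h2 hR N P s hN hs A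
  have hz := hs.scaledLoad_nonpos hx.β_pos hN
  have hz1 := hs.exp_scaledLoad_le_one hx.β_pos hN hθ.le
  obtain ⟨j₀, hj₀⟩ := Finite.exists_max fun j => Real.exp (θ * A.w j)
  have hmono : ∀ {a b : ℝ}, a ≤ b → Real.exp (θ * a) ≤ Real.exp (θ * b) := fun h =>
    Real.exp_le_exp.2 (mul_le_mul_of_nonneg_left h hθ.le)
  have hdr := hx.priceDrift_le_of_pos hl hθ (by linarith) hK h2 h1
    (u := fun i => Real.exp (θ * A.y i)) (v := fun j => Real.exp (θ * A.w j))
    (z := scaledLoad β R s) (B := B) (c := fun i => if SeesIdle (Basic x) N s i then B else 1)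
    (c' := fun j => if SeesWaiting (Basic x) s j then 1 else B)
    (fun _ => (Real.exp_pos _).le) (fun _ => (Real.exp_pos _).le)
    (fun i j h => hmono (A.y_le_w i j h)) hz
    (A.scaledLoad_mul_exp hx.β_pos hR hN hs θ) (by linarith)
    (fun i => by split_ifs <;> linarith)
    (fun j => by split_ifs <;> linarith)
    -- The large coefficient `B` occurs only at pool levels, which are nonpositive, so the price is
    -- at most 1 and `B` enters additively. The leading coefficient of the price stays 1.
    (fun i => by
      have hpos := Real.exp_pos (θ * A.y i)
      split_ifs with h
      · obtain ⟨j, hj⟩ := (A.y_of_idle i h).1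
        have : Real.exp (θ * A.y i) ≤ 1 := hj ▸ hz1 j
        nlinarith
      · linarith)
    (fun j => by
      have hpos := Real.exp_pos (θ * A.w j)
      split_ifs with h
      · linarith
      · have : Real.exp (θ * A.w j) ≤ 1 := by rw [A.w_of_not_waiting j h]; exact hz1 j
        nlinarith)
    hj₀ ⟨j₀, rfl⟩
  refine hdr.trans ?_
  set M := Real.exp (θ * A.w j₀) with hM
  have hF : expFunctional β R θ s ≤ n * (M + 1) + ∑ j, β j := by
    rw [expFunctional_eq]
    refine add_le_add ?_ (Finset.sum_le_sum fun j _ =>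
      mul_le_of_le_one_right (hx.β_pos j).le (hz1 j))
    have : ∀ i ∈ Finset.univ, Real.exp (θ * scaledQueue R s i) ≤ M + 1 := by
      intro i _
      rcases Nat.eq_zero_or_pos (s.queue i) with h | h
      · have hM0 := Real.exp_pos (θ * A.w j₀)
        simp only [scaledQueue, h, Nat.cast_zero, zero_div, mul_zero, Real.exp_zero]
        linarith
      · obtain ⟨j, hj⟩ := exists_edge_of_class hx.connected i
        have h3 := (hmono (A.queue_le i j hj h)).trans (hj₀ j)
        linarith
    simpa [hn, mul_add] using Finset.sum_le_card_nsmul _ _ _ this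
  have hcF := mul_le_mul_of_nonneg_left hF (div_pos hc0 hn0).le
  have e : Λ * θ * ((C - θ) / 2) / n * (n * (M + 1) + ∑ j, β j)
      = Λ * θ * ((C - θ) / 2) * M + Λ * θ * ((C - θ) / 2) / n * (n + ∑ j, β j) := by
    field_simp
    ring
  rw [e] at hcF
  linarith

/-- Exponential moments with a negative exponent. -/
lemma CriticalFlow.exists_expect_le_of_neg (hx : CriticalFlow lam β m x) {μ : I → J → ℝ}
    (hμ : ∀ i j, 0 ≤ μ i j) (hm : ∀ i j, Basic x i j → μ i j = m j) {l : I → ℝ}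
    {r : ℕ → ℝ} (hr_lim : Filter.Tendsto r Filter.atTop Filter.atTop)
    {N : ℕ → J → ℕ} (hN : ∀ n j, (N n j : ℝ) = r n * β j)
    {P : (n : ℕ) → Policy (Basic x) β (N n)} {p : ℕ → PMF (State I J)}
    (hp : ∀ᶠ n in Filter.atTop,
      IsStationary (P n) (fun i => r n * lam i + √(r n) * l i) μ (p n))
    {θ : ℝ} (hθ : θ < 0) :
    ∃ K : ℝ, ∀ᶠ n in Filter.atTop,
      expect (p n) (expFunctional β (r n) θ) ≤ ENNReal.ofReal K := by
  classical
  obtain ⟨B, hB1, hB⟩ := exists_inv_bound hx.β_pos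
  set Λ := ∑ i, lam i with hΛ
  have hΛ0 : 0 < Λ := Finset.sum_pos (fun i _ => hx.lam_pos i) Finset.univ_nonempty
  set L := ∑ i, |l i| with hL
  have hL0 : 0 ≤ L := Finset.sum_nonneg fun i _ => abs_nonneg _
  obtain ⟨j₁, hj₁⟩ := Finite.exists_min fun j => β j * m j
  have hε : 0 < β j₁ * m j₁ := mul_pos (hx.β_pos _) (hx.m_pos _)
  -- `T` is chosen so that the restoring rate exceeds the other terms by exactly 1.
  set W := 1 - θ * L + θ ^ 2 * ((2 * Λ + L) * B) with hW
  have hW0 : 0 < W := by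
    have h1 := mul_nonneg (neg_nonneg.2 hθ.le) hL0
    have h2 : 0 ≤ θ ^ 2 * ((2 * Λ + L) * B) := by positivity
    linarith
  obtain ⟨T, hT0, hT⟩ : ∃ T, 0 ≤ T ∧ -θ * (T * (β j₁ * m j₁)) = W :=
    ⟨W / (-θ * (β j₁ * m j₁)), by have := neg_pos.2 hθ; positivity, by
      have := mul_pos (neg_pos.2 hθ) hε
      rw [mul_left_comm, div_mul_cancel₀ _ this.ne']⟩
  set n : ℝ := Fintype.card I + ∑ j, β j with hn
  have hn0 : 0 < n := by
    have : (0 : ℝ) < Fintype.card I := by exact_mod_cast Fintype.card_pos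
    have hS : 0 ≤ ∑ j, β j := Finset.sum_nonneg fun j _ => (hx.β_pos j).le
    linarith
  refine ⟨_, hx.eventually_expect_le (b := -θ * (T * Real.exp (-(θ * T)) * Λ)) (c := 1 / n)
    (κ := 1) hμ hm hr_lim hN hp (by norm_num) hB ?_ (by positivity) ?_⟩
  · have := neg_pos.2 hθ
    positivity
  filter_upwards [Real.tendsto_sqrt_atTop.eventually_ge_atTop 1,
    Filter.eventually_gt_atTop 0] with R h1 hR N P s hN hs A
  have hz := hs.scaledLoad_nonpos hx.β_pos hN
  set H := ∑ j, Real.exp (θ * scaledLoad β R s j) with hH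
  have hzH : ∀ j, Real.exp (θ * scaledLoad β R s j) ≤ H := fun j =>
    Finset.single_le_sum (f := fun j => Real.exp (θ * scaledLoad β R s j))
      (fun _ _ => (Real.exp_pos _).le) (Finset.mem_univ j)
  have hH1 : 1 ≤ H :=
    (Real.one_le_exp (mul_nonneg_of_nonpos_of_nonpos hθ.le (hz j₁))).trans (hzH j₁)
  have hle1 : ∀ {a : ℝ}, 0 ≤ a → Real.exp (θ * a) ≤ H := fun h =>
    (Real.exp_le_one_iff.2 (mul_nonpos_of_nonpos_of_nonneg hθ.le h)).trans hH1
  have hdr := hx.priceDrift_le_of_neg (l := l) hθ h1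
    (u := fun i => Real.exp (θ * A.y i)) (v := fun j => Real.exp (θ * A.w j))
    (z := scaledLoad β R s) (B := B) (c := fun i => if SeesIdle (Basic x) N s i then B else 1)
    (c' := fun j => if SeesWaiting (Basic x) s j then 1 else B)
    (fun _ => (Real.exp_pos _).le) (fun _ => (Real.exp_pos _).le)
    (fun i j h => Real.exp_le_exp.2 (mul_le_mul_of_nonpos_left (A.y_le_w i j h) hθ.le)) hz
    (A.scaledLoad_mul_exp hx.β_pos hR hN hs θ) (by linarith)
    (fun i => by split_ifs <;> linarith)
    (fun j => by split_ifs <;> linarith)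
    (fun i => by split_ifs <;> linarith)
    (fun j => by split_ifs <;> linarith)
    (fun i => by
      by_cases h : SeesIdle (Basic x) N s i
      · obtain ⟨j, hj⟩ := (A.y_of_idle i h).1
        rw [hj]
        exact hzH j
      · rw [A.y_of_not_idle i h]
        exact hle1 (scaledQueue_nonneg R s i))
    (fun j => by
      by_cases h : SeesWaiting (Basic x) s j
      · exact hle1 (A.w_nonneg_of_waiting j h)
      · rw [A.w_of_not_waiting j h]
        exact hzH j)
    hj₁ hT0
  refine hdr.trans ?_
  rw [hT, ← hH, ← hL, ← hΛ]
  have hF : expFunctional β R θ s ≤ n * H := by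
    rw [expFunctional_eq, hn, add_mul]
    refine add_le_add ?_ ?_
    · simpa using Finset.sum_le_card_nsmul Finset.univ
        (fun i => Real.exp (θ * scaledQueue R s i)) H fun i _ => hle1 (scaledQueue_nonneg R s i)
    · rw [Finset.sum_mul]
      exact Finset.sum_le_sum fun j _ => mul_le_mul_of_nonneg_left (hzH j) (hx.β_pos j).le
  have hcF : 1 / n * expFunctional β R θ s ≤ H := by
    rw [one_div, ← div_eq_inv_mul, div_le_iff₀ hn0]
    linarith
  have e : W + θ * L - θ ^ 2 * ((2 * Λ + L) * B) = 1 := by rw [hW]; ring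
  rw [e]
  linarith

end Moments

/-! ### Tightness -/

/-- The positive exponent controls long queues and the exponent `-1` large idleness, through
Markov's inequality and the linear lower bound on `exp`. Each single law is a finite measure, so
bounds for large `n` suffice. -/
lemma isTightMeasureSet_scaledLaw {I J : Type*} [Fintype I] [Fintype J] {β : J → ℝ}
    (hβ : ∀ j, 0 < β j) {r : ℕ → ℝ} {p : ℕ → PMF (State I J)} {θ K₁ K₂ : ℝ} (hθ : 0 < θ)
    (h₁ : ∀ᶠ n in Filter.atTop,
      expect (p n) (expFunctional β (r n) θ) ≤ ENNReal.ofReal K₁)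
    (h₂ : ∀ᶠ n in Filter.atTop,
      expect (p n) (expFunctional β (r n) (-1)) ≤ ENNReal.ofReal K₂) :
    MeasureTheory.IsTightMeasureSet (Set.range fun n => scaledLaw β (r n) (p n)) := by
  have : ∀ n, MeasureTheory.IsFiniteMeasure (scaledLaw β (r n) (p n)) := fun n => by
    unfold scaledLaw; infer_instance
  refine MeasureTheory.isTightMeasureSet_range_of_tendsto_limsup_measure_norm_gt ?_
  set κ := min θ 1 with hκ
  have hκ0 : 0 < κ := lt_min hθ one_pos
  have hexp : ∀ b a : ℝ, 0 < b → b * Real.exp (a / b) ≥ a := fun b a hb => by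
    have := mul_le_mul_of_nonneg_left (Real.add_one_le_exp (a / b)) hb.le
    rw [mul_add, mul_div_cancel₀ _ hb.ne'] at this
    linarith
  have hlarge : ∀ R : ℝ, 0 < R → ∀ n s,
      R < ‖((scaledQueue (r n) s, scaledIdle β (r n) s) : (I → ℝ) × (J → ℝ))‖ →
      κ * R ≤ expFunctional β (r n) θ s + expFunctional β (r n) (-1) s := by
    intro R hR n s h
    have hκθ : κ * R ≤ θ * R := mul_le_mul_of_nonneg_right (min_le_left _ _) hR.le
    have hκ1 : κ * R ≤ R := mul_le_of_le_one_left hR.le (min_le_right _ _)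
    have hpos : ∀ ϑ, 0 ≤ ∑ i, Real.exp (ϑ * scaledQueue (r n) s i) := fun ϑ =>
      Finset.sum_nonneg fun _ _ => (Real.exp_pos _).le
    have hpos' : ∀ ϑ, 0 ≤ ∑ j, β j * Real.exp (ϑ * scaledIdle β (r n) s j / β j) := fun ϑ =>
      Finset.sum_nonneg fun j _ => mul_nonneg (hβ j).le (Real.exp_pos _).le
    have hterm : ∀ ϑ j, β j * Real.exp (ϑ * scaledIdle β (r n) s j / β j) ≤
        ∑ j, β j * Real.exp (ϑ * scaledIdle β (r n) s j / β j) := fun ϑ j =>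
      Finset.single_le_sum (f := fun j => β j * Real.exp (ϑ * scaledIdle β (r n) s j / β j))
        (fun j _ => mul_nonneg (hβ j).le (Real.exp_pos _).le) (Finset.mem_univ j)
    unfold expFunctional
    rw [Prod.norm_def, lt_sup_iff] at h
    rcases h with h | h
    · obtain ⟨i, hi⟩ : ∃ i, R < ‖scaledQueue (r n) s i‖ := by
        by_contra! hall
        exact absurd ((pi_norm_le_iff_of_nonneg hR.le).2 hall) (not_le.2 h)
      rw [Real.norm_of_nonneg (scaledQueue_nonneg _ _ _)] at hi
      have h1 := Finset.single_le_sum (f := fun i => Real.exp (θ * scaledQueue (r n) s i))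
        (fun _ _ => (Real.exp_pos _).le) (Finset.mem_univ i)
      have h2 := Real.add_one_le_exp (θ * scaledQueue (r n) s i)
      have h3 := mul_le_mul_of_nonneg_left hi.le hθ.le
      have := hpos (-1)
      have := hpos' (-1)
      have := hpos' θ
      linarith
    · obtain ⟨j, hj⟩ : ∃ j, R < ‖scaledIdle β (r n) s j‖ := by
        by_contra! hall
        exact absurd ((pi_norm_le_iff_of_nonneg hR.le).2 hall) (not_le.2 h)
      have p1 := hpos (-1)
      have p2 := hpos' (-1)
      have p3 := hpos θ
      have p4 := hpos' θ
      -- Both signs are treated, since the states are not assumed admissible here.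
      rcases lt_abs.1 hj with h' | h'
      · have h1 := hexp (β j) (θ * scaledIdle β (r n) s j) (hβ j)
        have h2 := mul_le_mul_of_nonneg_left h'.le hθ.le
        have h3 := hterm θ j
        linarith
      · have h1 := hexp (β j) (-1 * scaledIdle β (r n) s j) (hβ j)
        have h3 := hterm (-1) j
        linarith
  have hbound : ∀ R : ℝ, 0 < R → ∀ᶠ n in Filter.atTop,
      scaledLaw β (r n) (p n) {y | R < ‖y‖} ≤
        (ENNReal.ofReal K₁ + ENNReal.ofReal K₂) / ENNReal.ofReal (κ * R) := by
    intro R hR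
    have hκR : 0 < κ * R := mul_pos hκ0 hR
    filter_upwards [h₁, h₂] with n hn₁ hn₂
    rw [scaledLaw, PMF.toMeasure_apply_eq_toOuterMeasure_apply _
      (measurableSet_lt measurable_const measurable_norm), PMF.toOuterMeasure_map_apply,
      PMF.toOuterMeasure_apply,
      ENNReal.le_div_iff_mul_le (Or.inl (by simpa using hκR)) (Or.inl ENNReal.ofReal_ne_top)]
    refine le_trans ?_ (add_le_add hn₁ hn₂)
    rw [expect, expect, ← ENNReal.tsum_add, ← ENNReal.tsum_mul_right]
    refine ENNReal.tsum_le_tsum fun s => ?_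
    rw [← mul_add, ← ENNReal.ofReal_add]
    · by_cases hs : s ∈ (fun s => (scaledQueue (r n) s, scaledIdle β (r n) s)) ⁻¹' {y | R < ‖y‖}
      · rw [Set.indicator_of_mem hs]
        gcongr
        exact hlarge R hR n s hs
      · rw [Set.indicator_of_notMem hs, zero_mul]
        exact zero_le
    · exact expFunctional_nonneg hβ _ _ _
    · exact expFunctional_nonneg hβ _ _ _
  have hlim : Filter.Tendsto (fun R : ℝ =>
      (ENNReal.ofReal K₁ + ENNReal.ofReal K₂) / ENNReal.ofReal (κ * R)) Filter.atTop (nhds 0) := by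
    have h1 : Filter.Tendsto (fun R : ℝ => ENNReal.ofReal (κ * R)) Filter.atTop (nhds ⊤) :=
      ENNReal.tendsto_ofReal_atTop.comp (Filter.tendsto_id.const_mul_atTop hκ0)
    have h2 := ENNReal.Tendsto.const_div h1
      (a := ENNReal.ofReal K₁ + ENNReal.ofReal K₂) (Or.inr (by simp))
    simpa using h2
  refine tendsto_of_tendsto_of_tendsto_of_le_of_le' tendsto_const_nhds hlim
    (Filter.Eventually.of_forall fun _ => zero_le) ?_
  filter_upwards [Filter.eventually_gt_atTop 0] with R hR
  exact Filter.limsup_le_of_le (by isBoundedDefault) (hbound R hR)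

end LQFS

/-! ### Conclusion: exponential moments and tightness. -/

theorem mainTheorem3 {I J : Type*} [Fintype I] [Fintype J] [Nonempty I] [Nonempty J]
    [DecidableEq I] [DecidableEq J]
    (lam : I → ℝ) (β : J → ℝ) (μ : I → J → ℝ)
    (hlam : ∀ i, 0 < lam i) (hβ : ∀ j, 0 < β j) (hμ : ∀ i j, 0 ≤ μ i j)
    (x : I → J → ℝ) (ρ : ℝ) (hcrp : LQFS.CompleteResourcePooling lam β μ x ρ) (hρ : ρ = 1)
    (m : J → ℝ) (hm : ∀ i j, LQFS.Basic x i j → μ i j = m j)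
    (ν : I → ℝ) (α : J → ℝ) (hdual : LQFS.DualOptimal lam β μ ν α)
    (l : I → ℝ) (C : ℝ) (hC : 0 < C) (hl : ∑ i, l i * ν i = -C)
    (r : ℕ → ℝ) (hr : ∀ n, 0 < r n) (hr_lim : Filter.Tendsto r Filter.atTop Filter.atTop)
    (N : ℕ → J → ℕ) (hN : ∀ n j, (N n j : ℝ) = r n * β j)
    (P : (n : ℕ) → LQFS.Policy (LQFS.Basic x) β (N n))
    (p : ℕ → PMF (LQFS.State I J))
    (hp : ∀ᶠ n in Filter.atTop,
      LQFS.IsStationary (P n) (fun i => r n * lam i + √(r n) * l i) μ (p n)) :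
    (∀ θ : ℝ,
      θ < 2 * C * Finset.univ.inf' Finset.univ_nonempty lam /
          (∑ i, lam i + Finset.univ.sup' Finset.univ_nonempty m * ∑ j, β j) →
      Filter.limsup (fun n => LQFS.expect (p n) (LQFS.expFunctional β (r n) θ)) Filter.atTop < ⊤) ∧
    MeasureTheory.IsTightMeasureSet (Set.range fun n => LQFS.scaledLaw β (r n) (p n)) := by
  subst hρ
  obtain ⟨hopt, -, htree⟩ := hcrp
  have hconn := htree.connected
  have hm0 : ∀ j, 0 < m j := fun j => by
    obtain ⟨i, hij⟩ := LQFS.exists_edge_of_pool hconn j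
    rw [← hm i j hij]
    exact hij.rate_pos hμ hopt.1
  have hx : LQFS.CriticalFlow lam β m x :=
    ⟨hlam, hβ, hm0, hopt.1.1, hopt.1.2.2.1,
      LQFS.sum_flow_eq_capacity hβ hopt hconn hm hm0, hconn⟩
  have hΛ : 0 < ∑ i, lam i := Finset.sum_pos (fun i _ => hlam i) Finset.univ_nonempty
  have hlC : ∑ i, l i = -(C * ∑ i, lam i) := by
    rw [← neg_mul, ← hl, Finset.sum_mul]
    refine Finset.sum_congr rfl fun i _ => ?_
    rw [mul_assoc, LQFS.dual_price_eq hβ hopt hconn hm hm0 hdual i, mul_one]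
  -- Since `∑ β j * m j = ∑ lam i`, the denominator is at least twice `∑ lam i`, while the minimum
  -- of `lam` is at most that sum.
  have hθC : 2 * C * Finset.univ.inf' Finset.univ_nonempty lam /
      (∑ i, lam i + Finset.univ.sup' Finset.univ_nonempty m * ∑ j, β j) ≤ C := by
    have h1 : Finset.univ.inf' Finset.univ_nonempty lam ≤ ∑ i, lam i := by
      obtain ⟨i⟩ := ‹Nonempty I›
      exact (Finset.inf'_le lam (Finset.mem_univ i)).trans
        (Finset.single_le_sum (fun i _ => (hlam i).le) (Finset.mem_univ i))
    have h2 : ∑ i, lam i ≤ Finset.univ.sup' Finset.univ_nonempty m * ∑ j, β j := by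
      rw [← hx.sum_capacity, Finset.mul_sum]
      refine Finset.sum_le_sum fun j _ => ?_
      rw [mul_comm]
      exact mul_le_mul_of_nonneg_right (Finset.le_sup' m (Finset.mem_univ j)) (hβ j).le
    rw [div_le_iff₀ (by linarith), mul_comm 2 C, mul_assoc]
    exact mul_le_mul_of_nonneg_left (by linarith) hC.le
  refine ⟨fun θ hθ => ?_, ?_⟩
  · obtain ⟨K, hK⟩ : ∃ K : ℝ, ∀ᶠ n in Filter.atTop,
        LQFS.expect (p n) (LQFS.expFunctional β (r n) θ) ≤ ENNReal.ofReal K := by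
      rcases lt_trichotomy θ 0 with h | rfl | h
      · exact hx.exists_expect_le_of_neg hμ hm hr_lim hN hp h
      -- At exponent 0 the functional is this constant.
      · refine ⟨Fintype.card I + ∑ j, β j, Filter.Eventually.of_forall fun n => ?_⟩
        simp [LQFS.expect, LQFS.expFunctional, ENNReal.tsum_mul_right, (p n).tsum_coe]
      · exact hx.exists_expect_le_of_pos hμ hm hlC hr_lim hN hp h (hθ.trans_le hθC)
    exact (Filter.limsup_le_of_le (by isBoundedDefault) hK).trans_lt ENNReal.ofReal_lt_top
  · obtain ⟨K₁, h₁⟩ := hx.exists_expect_le_of_pos hμ hm hlC hr_lim hN hp (half_pos hC)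
      (half_lt_self hC)
    obtain ⟨K₂, h₂⟩ := hx.exists_expect_le_of_neg hμ hm hr_lim hN hp (θ := -1) (by norm_num)
    exact LQFS.isTightMeasureSet_scaledLaw hβ (half_pos hC) h₁ h₂
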